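/- **Setting.** A *reductive structure* $(G_A,G_B;E)$ consists of a real Banach–Lie group $G_A$ with Lie algebra $\mathfrak g_A$, a Banach–Lie subgroup $G_B\subseteq G_A$ with Lie algebra $\mathfrak g_B\subseteq\mathfrak g_A$ (a subgroup which, with the topology of $G_A$, is a Banach–Lie group smoothly embedded in $G_A$, the tangent ranges of the inclusion being complemented), and a continuous linear map $E\colon\mathfrak g_A\to\mathfrak g_A$ with $E\circ E=E$, $\operatorname{Ran}E=\mathfrak g_B$ and $E\circ\mathrm{Ad}(g)=\mathrm{Ad}(g)\circ E$ for all $g\in G_B$. A *morphism* $\alpha$ from $(G_A,G_B;E)$ to $(\widetilde G_A,\widetilde G_B;\widetilde E)$ is a smooth group homomorphism $\alpha\colon G_A\to\widetilde G_A$ with $\alpha(G_B)\subseteq\widetilde G_B$ and $d\alpha\circ E=\widetilde E\circ d\alpha$. For a norm-continuous representation $\rho_B\colon G_B\to\mathcal B(\mathcal H_B)$ on a complex Hilbert space let $\Pi\colon D=G_A\times_{G_B}\mathcal H_B\to G_A/G_B$, $[(g,f)]\mapsto gG_B$, be the homogeneous vector bundle, where $(g,f)\sim(gw,\rho_B(w^{-1})f)$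 for $w\in G_B$, with the canonical Banach manifold structures on $D$ and $G_A/G_B$. For $g\in G_A$, $X\in\mathfrak g_A$, $f,h\in\mathcal H_B$ denote by $[((g,X),(f,h))]\in TD$ the image of $(T_{\mathbf 1}\lambda_g X,h)\in T_{(g,f)}(G_A\times\mathcal H_B)$, $\lambda_g(x)=gx$, under the tangent map of $(g,f)\mapsto[(g,f)]$; every tangent vector of $D$ has this form. The connection induced by the reductive structure is the well-defined map $$\Phi_E\colon TD\to TD,\qquad [((g,X),(f,h))]\mapsto[((g,E(X)),(f,h))].$$ A *connection* on a bundle $\varphi\colon M\to Z$ is a smooth map $\Phi\colon TM\to TM$ with $\Phi\circ\Phi=\Phi$ which restricts for each $x\in M$ to a continuous linear map $\Phi_x\colon T_xM\to T_xM$ with $\operatorname{Ran}\Phi_x=\operatorname{Ker}T_x\varphi$. Let $\Theta=(\delta,\zeta)$ be a smooth bundle homomorphism from $\varphi\colon M\to Z$ to $\widetilde\varphi\colon\widetilde M\to\widetilde Z$ (so $\widetilde\varphi\circ\delta=\zeta\circ\varphi$) such that $\delta$ maps each fibre $\varphi^{-1}(s)$ diffeomorphically onto $\widetilde\varphi^{-1}(\zeta(s))$.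 The *pull-back* $\Theta^*(\widetilde\Phi)$ of a connection $\widetilde\Phi$ on $\widetilde\varphi$ is the unique connection $\Phi$ on $\varphi$ with $T\delta\circ\Phi=\widetilde\Phi\circ T\delta$. **Proposition.** Let $\alpha$ be a morphism of reductive structures from $(G_A,G_B;E)$ to $(\widetilde G_A,\widetilde G_B;\widetilde E)$, let $\widetilde\rho_B\colon\widetilde G_B\to\mathcal B(\mathcal H_B)$ be a norm-continuous representation on a complex Hilbert space and put $\rho_B=\widetilde\rho_B\circ\alpha|_{G_B}$. Let $\Pi\colon D\to G_A/G_B$ and $\widetilde\Pi\colon\widetilde D\to\widetilde G_A/\widetilde G_B$ be the homogeneous vector bundles induced by $\rho_B$ and $\widetilde\rho_B$, with the induced connections $\Phi_E$ and $\widetilde\Phi_{\widetilde E}$, and let $\Theta=(\delta,\zeta)$, $$\delta([(g,f)])=[(\alpha(g),f)],\qquad \zeta(gG_B)=\alpha(g)\widetilde G_B .$$ Then $\Theta$ is a smooth bundle homomorphism which is a diffeomorphism on each fibre, $\Phi_E$ and $\widetilde\Phi_{\widetilde E}$ are connections, and $$\Theta^*(\widetilde\Phi_{\widetilde E})=\Phi_E,$$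 that is, $\Phi_E$ is the unique connection on $\Pi$ with $T\delta\circ\Phi_E=\widetilde\Phi_{\widetilde E}\circ T\delta$. -/

import Mathlib

open Set Function Topology
open scoped Manifold ContDiff

noncomputable section

theorem exists_smooth_localInverse {X Y : Type*} [NormedAddCommGroup X] [NormedSpace ℝ X]
    [CompleteSpace X] [NormedAddCommGroup Y] [NormedSpace ℝ Y] {Ψ : X → Y} {O : Set X} {x : X}
    (hO : IsOpen O) (hx : x ∈ O) (hΨ : ContDiffOn ℝ ∞ Ψ O) (e : X ≃L[ℝ] Y)
    (he : HasFDerivAt Ψ (e : X →L[ℝ] Y) x) :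
    ∃ P : OpenPartialHomeomorph X Y, x ∈ P.source ∧ P.source ⊆ O ∧ (∀ y, P y = Ψ y) ∧
      ContDiffOn ℝ ∞ P.symm P.target := by
  have hx' : ContDiffAt ℝ ∞ Ψ x := hΨ.contDiffAt (hO.mem_nhds hx)
  let P₀ := hx'.toOpenPartialHomeomorph Ψ he (by simp)
  have hP₀ : ∀ y, P₀ y = Ψ y := fun y => rfl
  have hxP₀ : x ∈ P₀.source := hx'.mem_toOpenPartialHomeomorph_source he (by simp)
  let R : Set (X →L[ℝ] Y) := range ((↑) : (X ≃L[ℝ] Y) → X →L[ℝ] Y)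
  have hR : IsOpen R := ContinuousLinearEquiv.isOpen
  have hfd : ContinuousOn (fderiv ℝ Ψ) O := hΨ.continuousOn_fderiv_of_isOpen hO (by simp)
  have hO' : IsOpen (O ∩ fderiv ℝ Ψ ⁻¹' R) := hfd.isOpen_inter_preimage hO hR
  refine ⟨P₀.restrOpen _ hO', ?_, ?_, hP₀, ?_⟩
  · refine ⟨hxP₀, hx, e, he.fderiv.symm⟩
  · intro y hy
    exact hy.2.1
  · intro y hy
    refine ContDiffAt.contDiffWithinAt ?_
    have hs := (P₀.restrOpen _ hO').map_target hy
    obtain ⟨e', he'⟩ := hs.2.2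
    have hc : ContDiffAt ℝ ∞ Ψ ((P₀.restrOpen _ hO').symm y) :=
      hΨ.contDiffAt (hO.mem_nhds hs.2.1)
    refine OpenPartialHomeomorph.contDiffAt_symm _ hy (f₀' := e') ?_ hc
    rw [he']
    exact (hc.differentiableAt (by simp)).hasFDerivAt

/-- The chart of a quotient defined by a slice `s` of an open quotient map `q` and by the associated
coordinate `r`. -/
def chartOfSlice {M N V : Type*} [TopologicalSpace M] [TopologicalSpace N] [TopologicalSpace V]
    (q : M → N) (hq : IsOpenQuotientMap q) (W : Set M) (U : Set V) (s : V → M) (r : M → V)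
    (hW : IsOpen W) (hU : IsOpen U) (hs : ContinuousOn s U) (hr : ContinuousOn r W)
    (sW : ∀ v ∈ U, s v ∈ W) (rU : ∀ m ∈ W, r m ∈ U) (rs : ∀ v ∈ U, r (s v) = v)
    (qsr : ∀ m ∈ W, q (s (r m)) = q m)
    (inv : ∀ m ∈ W, ∀ m', q m = q m' → r m' = r m) :
    OpenPartialHomeomorph N V :=
  have hcomp : ∀ m ∈ W, r (surjInv hq.surjective (q m)) = r m := fun m hm =>
    inv m hm _ (surjInv_eq hq.surjective (q m)).symm
  { toFun := fun n => r (surjInv hq.surjective n)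
    invFun := fun v => q (s v)
    source := q '' W
    target := U
    map_source' := by
      rintro _ ⟨m, hm, rfl⟩
      rw [hcomp m hm]
      exact rU m hm
    map_target' := fun v hv => ⟨s v, sW v hv, rfl⟩
    left_inv' := by
      rintro _ ⟨m, hm, rfl⟩
      rw [hcomp m hm, qsr m hm]
    right_inv' := by
      intro v hv
      rw [hcomp _ (sW v hv), rs v hv]
    open_source := hq.isOpenMap W hW
    open_target := hU
    continuousOn_toFun := by
      rintro _ ⟨m, hm, rfl⟩
      refine ContinuousAt.continuousWithinAt ?_
      rw [ContinuousAt, ← hq.map_nhds_eq, Filter.tendsto_map'_iff, hcomp m hm]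
      refine (hr.continuousAt (hW.mem_nhds hm)).congr' ?_
      filter_upwards [hW.mem_nhds hm] with m' hm'
      exact (hcomp m' hm').symm
    continuousOn_invFun := hq.continuous.comp_continuousOn hs }

/-- A Banach--Lie subgroup `G_B` (modelled on the Banach space `EB`) of the real Banach--Lie group
`GA` (modelled on the Banach space `EA`): a subgroup which, with the topology inherited from `GA`,
is a Banach--Lie group whose inclusion into `GA` is a smooth embedding.  (In Mathlib an immersion of
Banach manifolds has, by definition, a complemented tangent range.) -/
structure BanachLieSubgroup (EA EB GA : Type*)
    [NormedAddCommGroup EA] [NormedSpace ℝ EA] [NormedAddCommGroup EB] [NormedSpace ℝ EB]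
    [TopologicalSpace GA] [ChartedSpace EA GA] [Group GA] where
  toSubgroup : Subgroup GA
  chartedSpace : ChartedSpace EB toSubgroup
  lieGroup : LieGroup 𝓘(ℝ, EB) ∞ toSubgroup
  isSmoothEmbedding : Manifold.IsSmoothEmbedding 𝓘(ℝ, EB) 𝓘(ℝ, EA) ∞
    (Subtype.val : toSubgroup → GA)

namespace BanachLieSubgroup

variable {EA EB GA : Type*}
  [NormedAddCommGroup EA] [NormedSpace ℝ EA]
  [NormedAddCommGroup EB] [NormedSpace ℝ EB]
  [TopologicalSpace GA] [ChartedSpace EA GA] [Group GA]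
  (S : BanachLieSubgroup EA EB GA)

attribute [instance] BanachLieSubgroup.chartedSpace BanachLieSubgroup.lieGroup

/-- A Banach space complementary to `EB` in `EA`; it is the model space of `G_A / G_B`. -/
abbrev Normal : Type _ := S.isSmoothEmbedding.isImmersion.complement

/-- A smooth slice through `1` for the right action of the subgroup `G_B` on `GA`: a smooth map `σ`
on an open neighbourhood `U` of `0` in the model space of the quotient, such that the set
`σ(U) G_B` is open and the coordinate `σ(c) h ↦ c` on it is well defined and smooth. -/
structure Slice where
  U : Set S.Normal
  σ : S.Normal → GA
  r : GA → S.Normal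
  isOpen_U : IsOpen U
  zero_mem : (0 : S.Normal) ∈ U
  σ_zero : σ 0 = 1
  smooth_σ : ContMDiffOn 𝓘(ℝ, S.Normal) 𝓘(ℝ, EA) ∞ σ U
  isOpen_W : IsOpen {g : GA | ∃ c ∈ U, ∃ h ∈ S.toSubgroup, g = σ c * h}
  smooth_r : ContMDiffOn 𝓘(ℝ, EA) 𝓘(ℝ, S.Normal) ∞ r
    {g : GA | ∃ c ∈ U, ∃ h ∈ S.toSubgroup, g = σ c * h}
  r_eq : ∀ c ∈ U, ∀ h ∈ S.toSubgroup, r (σ c * h) = c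

/-- Adapted coordinates at the unit element. -/
theorem exists_adapted_coordinates [LieGroup 𝓘(ℝ, EA) ∞ GA] :
    ∃ (φ : OpenPartialHomeomorph GA EA) (d : OpenPartialHomeomorph S.toSubgroup EB)
      (e : (EB × S.Normal) ≃L[ℝ] EA),
      φ ∈ IsManifold.maximalAtlas 𝓘(ℝ, EA) ∞ GA ∧
      (1 : GA) ∈ φ.source ∧ (1 : S.toSubgroup) ∈ d.source ∧
      φ 1 = e (d 1, 0) ∧
      (∀ y ∈ d.target, ((d.symm y : S.toSubgroup) : GA) ∈ φ.source ∧
        φ (d.symm y : S.toSubgroup) = e (y, 0)) := by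
  have h : Manifold.IsImmersionAtOfComplement S.Normal 𝓘(ℝ, EB) 𝓘(ℝ, EA) ∞
      (Subtype.val : S.toSubgroup → GA) 1 :=
    S.isSmoothEmbedding.isImmersion.isImmersionOfComplement_complement 1
  have hw : ∀ y ∈ h.domChart.target, h.codChart (h.domChart.symm y : S.toSubgroup)
      = h.equiv (y, 0) := by
    intro y hy
    have hy' : y ∈ (h.domChart.extend 𝓘(ℝ, EB)).target := by
      rw [OpenPartialHomeomorph.extend_target]
      exact ⟨hy, mem_range_self y⟩
    exact h.writtenInCharts hy'
  refine ⟨h.codChart, h.domChart, h.equiv, h.codChart_mem_maximalAtlas,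
    by simpa using h.mem_codChart_source, h.mem_domChart_source, ?_, ?_⟩
  · have := hw _ (h.domChart.map_source h.mem_domChart_source)
    rw [h.domChart.left_inv h.mem_domChart_source] at this
    simpa using this
  · intro y hy
    exact ⟨h.source_subset_preimage_source (h.domChart.map_target hy), hw y hy⟩

theorem nonempty_slice [CompleteSpace EA] [LieGroup 𝓘(ℝ, EA) ∞ GA] : Nonempty S.Slice := by
  obtain ⟨φ, d, e, hφ, h1φ, h1d, h1, hd⟩ := S.exists_adapted_coordinates
  have tg : IsTopologicalGroup GA := topologicalGroup_of_lieGroup 𝓘(ℝ, EA) ∞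
  have : CompleteSpace (EB × S.Normal) :=
    (completeSpace_congr (e := e.toLinearEquiv.toEquiv) e.isUniformEmbedding).2 inferInstance
  set a : EA := φ 1 with ha
  have aφ : a ∈ φ.target := φ.map_source h1φ
  have hφa : φ.symm a = 1 := φ.left_inv h1φ
  let σ : S.Normal → GA := fun c => φ.symm (a + e (0, c))
  let τ : EB → GA := fun b => φ.symm (a + e (b, 0))
  have hσ0 : σ 0 = 1 := by
    have : e ((0, 0) : EB × S.Normal) = 0 := e.map_zero
    simp [σ, this, hφa]
  have hτ0 : τ 0 = 1 := by
    have : e ((0, 0) : EB × S.Normal) = 0 := e.map_zero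
    simp [τ, this, hφa]
  have hφs := contMDiffOn_symm_of_mem_maximalAtlas hφ
  have hφ' := contMDiffOn_of_mem_maximalAtlas hφ
  let Uσ : Set S.Normal := (fun c => a + e (0, c)) ⁻¹' φ.target
  let Uτ : Set EB := (fun b => a + e (b, 0)) ⁻¹' φ.target
  have hUσ : IsOpen Uσ := φ.open_target.preimage (by fun_prop)
  have hUτ : IsOpen Uτ := φ.open_target.preimage (by fun_prop)
  have h0σ : (0 : S.Normal) ∈ Uσ := by
    have : e ((0, 0) : EB × S.Normal) = 0 := e.map_zero
    simpa [Uσ, this] using aφ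
  have h0τ : (0 : EB) ∈ Uτ := by
    have : e ((0, 0) : EB × S.Normal) = 0 := e.map_zero
    simpa [Uτ, this] using aφ
  have hσ : ContMDiffOn 𝓘(ℝ, S.Normal) 𝓘(ℝ, EA) ∞ σ Uσ := by
    refine hφs.comp (t := φ.target) ?_ (fun c hc => hc)
    refine ContDiff.contMDiff ?_ |>.contMDiffOn
    fun_prop
  have hτ : ContMDiffOn 𝓘(ℝ, EB) 𝓘(ℝ, EA) ∞ τ Uτ := by
    refine hφs.comp (t := φ.target) ?_ (fun c hc => hc)
    refine ContDiff.contMDiff ?_ |>.contMDiffOn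
    fun_prop
  let m : EB × S.Normal → GA := fun p => σ p.2 * τ p.1
  have hm : ContMDiffOn 𝓘(ℝ, EB × S.Normal) 𝓘(ℝ, EA) ∞ m (Uτ ×ˢ Uσ) := by
    refine ContMDiffOn.mul (hσ.comp (t := Uσ) ?_ (fun p hp => hp.2))
      (hτ.comp (t := Uτ) ?_ (fun p hp => hp.1))
    · exact contDiff_snd.contMDiff.contMDiffOn
    · exact contDiff_fst.contMDiff.contMDiffOn
  let O : Set (EB × S.Normal) := (Uτ ×ˢ Uσ) ∩ m ⁻¹' φ.source
  have hO : IsOpen O := hm.continuousOn.isOpen_inter_preimage (hUτ.prod hUσ) φ.open_source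
  let Ψ : EB × S.Normal → EA := fun p => φ (m p)
  have hΨ : ContDiffOn ℝ ∞ Ψ O := by
    rw [← contMDiffOn_iff_contDiffOn]
    exact hφ'.comp (hm.mono inter_subset_left) inter_subset_right
  have h0O : (0 : EB × S.Normal) ∈ O := by
    refine ⟨⟨h0τ, h0σ⟩, ?_⟩
    simpa [m, hσ0, hτ0] using h1φ
  have hder : HasFDerivAt Ψ (e : (EB × S.Normal) →L[ℝ] EA) 0 := by
    have hd0 := ((hΨ.contDiffAt (hO.mem_nhds h0O)).differentiableAt (by simp)).hasFDerivAt
    have hΨb : ∀ᶠ b in 𝓝 (0 : EB), Ψ (b, 0) = a + e (b, 0) := by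
      filter_upwards [hUτ.mem_nhds h0τ] with b hb
      simp only [Ψ, m, hσ0, one_mul]
      exact φ.right_inv hb
    have hΨc : ∀ᶠ c in 𝓝 (0 : S.Normal), Ψ (0, c) = a + e (0, c) := by
      filter_upwards [hUσ.mem_nhds h0σ] with c hc
      simp only [Ψ, m, hτ0, mul_one]
      exact φ.right_inv hc
    have h1 : (fderiv ℝ Ψ 0).comp (.inl ℝ EB S.Normal) =
        (e : (EB × S.Normal) →L[ℝ] EA).comp (.inl ℝ EB S.Normal) := by
      have A : HasFDerivAt (fun b : EB => Ψ (b, 0))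
          ((fderiv ℝ Ψ 0).comp (.inl ℝ EB S.Normal)) 0 :=
        HasFDerivAt.comp (g := Ψ) (0 : EB) hd0 (ContinuousLinearMap.inl ℝ EB S.Normal).hasFDerivAt
      have B : HasFDerivAt (fun b : EB => a + e (b, 0))
          ((e : (EB × S.Normal) →L[ℝ] EA).comp (.inl ℝ EB S.Normal)) 0 :=
        ((e : (EB × S.Normal) →L[ℝ] EA).comp (.inl ℝ EB S.Normal)).hasFDerivAt.const_add a
      exact A.unique (B.congr_of_eventuallyEq hΨb)
    have h2 : (fderiv ℝ Ψ 0).comp (.inr ℝ EB S.Normal) =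
        (e : (EB × S.Normal) →L[ℝ] EA).comp (.inr ℝ EB S.Normal) := by
      have A : HasFDerivAt (fun c : S.Normal => Ψ (0, c))
          ((fderiv ℝ Ψ 0).comp (.inr ℝ EB S.Normal)) 0 :=
        HasFDerivAt.comp (g := Ψ) (0 : S.Normal) hd0
          (ContinuousLinearMap.inr ℝ EB S.Normal).hasFDerivAt
      have B : HasFDerivAt (fun c : S.Normal => a + e (0, c))
          ((e : (EB × S.Normal) →L[ℝ] EA).comp (.inr ℝ EB S.Normal)) 0 :=
        ((e : (EB × S.Normal) →L[ℝ] EA).comp (.inr ℝ EB S.Normal)).hasFDerivAt.const_add a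
      exact A.unique (B.congr_of_eventuallyEq hΨc)
    have h3 : (e : (EB × S.Normal) →L[ℝ] EA) = fderiv ℝ Ψ 0 :=
      ContinuousLinearMap.prod_ext h1.symm h2.symm
    rw [h3]
    exact hd0
  obtain ⟨P, h0P, hPO, hPΨ, hPs⟩ := exists_smooth_localInverse hO h0O hΨ e hder
  -- a neighbourhood `B` of `0` in `EB` consisting of parameters of elements of the subgroup
  have hτd : ∀ b, d 1 + b ∈ d.target → τ b = (d.symm (d 1 + b) : S.toSubgroup) := by
    intro b hb
    obtain ⟨hs, hv⟩ := hd _ hb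
    have : a + e (b, 0) = e (d 1 + b, 0) := by
      rw [h1, ← map_add]
      simp
    simp only [τ, this, ← hv]
    exact φ.left_inv hs
  obtain ⟨B, U₀, hB, h0B, hU₀, h0U₀, hBU₀⟩ : ∃ (B : Set EB) (U₀ : Set S.Normal), IsOpen B ∧ 0 ∈ B ∧
      IsOpen U₀ ∧ 0 ∈ U₀ ∧ B ×ˢ U₀ ⊆ P.source := by
    obtain ⟨B, hB, U₀, hU₀, h⟩ := mem_nhds_prod_iff.1 (P.open_source.mem_nhds h0P)
    obtain ⟨B', hB', hBo, hB0⟩ := mem_nhds_iff.1 hB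
    obtain ⟨U', hU', hUo, hU0⟩ := mem_nhds_iff.1 hU₀
    exact ⟨B', U', hBo, hB0, hUo, hU0, (Set.prod_mono hB' hU').trans h⟩
  let B₁ : Set EB := B ∩ (fun b => d 1 + b) ⁻¹' d.target
  have hB₁ : IsOpen B₁ := hB.inter (d.open_target.preimage (by fun_prop))
  have h0B₁ : (0 : EB) ∈ B₁ := ⟨h0B, by simpa using d.map_source h1d⟩
  -- elements of the subgroup close to `1` have parameters in `B₁`
  obtain ⟨O₁, hO₁, h1O₁, hO₁B⟩ : ∃ O₁ : Set GA, IsOpen O₁ ∧ 1 ∈ O₁ ∧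
      ∀ h ∈ S.toSubgroup, h ∈ O₁ → ∃ b ∈ B₁, τ b = h := by
    have hV : IsOpen (d.source ∩ d ⁻¹' ((fun y => y - d 1) ⁻¹' B₁)) :=
      d.continuousOn.isOpen_inter_preimage d.open_source (hB₁.preimage (by fun_prop))
    obtain ⟨O₁, hO₁, hO₁'⟩ := isOpen_induced_iff.1 hV
    refine ⟨O₁, hO₁, ?_, ?_⟩
    · have : (1 : S.toSubgroup) ∈ d.source ∩ d ⁻¹' ((fun y => y - d 1) ⁻¹' B₁) :=
        ⟨h1d, by simpa using h0B₁⟩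
      rw [← hO₁'] at this
      exact this
    · intro h hh hhO
      have : (⟨h, hh⟩ : S.toSubgroup) ∈ d.source ∩ d ⁻¹' ((fun y => y - d 1) ⁻¹' B₁) := by
        rw [← hO₁']
        exact hhO
      refine ⟨d ⟨h, hh⟩ - d 1, this.2, ?_⟩
      rw [hτd _ this.2.2]
      simp [d.left_inv this.1]
  obtain ⟨U, hU, h0U, hUU₀, hUσ', hUO₁⟩ : ∃ U : Set S.Normal, IsOpen U ∧ 0 ∈ U ∧ U ⊆ U₀ ∧ U ⊆ Uσ ∧
      ∀ c ∈ U, ∀ c' ∈ U, (σ c)⁻¹ * σ c' ∈ O₁ := by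
    have hc : ContinuousAt (fun p : S.Normal × S.Normal => (σ p.1)⁻¹ * σ p.2) (0, 0) := by
      have h0 : ContinuousAt σ 0 := hσ.continuousOn.continuousAt (hUσ.mem_nhds h0σ)
      have hf : ContinuousAt (fun p : S.Normal × S.Normal => σ p.1) (0, 0) :=
        ContinuousAt.comp (f := Prod.fst) (g := σ) h0 continuousAt_fst
      have hs : ContinuousAt (fun p : S.Normal × S.Normal => σ p.2) (0, 0) :=
        ContinuousAt.comp (f := Prod.snd) (g := σ) h0 continuousAt_snd
      exact hf.inv.mul hs
    have hmem := hc.preimage_mem_nhds (hO₁.mem_nhds (by simpa [hσ0] using h1O₁))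
    obtain ⟨U₁, hU₁, U₂, hU₂, h⟩ := mem_nhds_prod_iff.1 hmem
    obtain ⟨U, hUsub, hUo, hU0⟩ := mem_nhds_iff.1 (Filter.inter_mem (Filter.inter_mem hU₁ hU₂)
      (Filter.inter_mem (hU₀.mem_nhds h0U₀) (hUσ.mem_nhds h0σ)))
    exact ⟨U, hUo, hU0, fun c hc => (hUsub hc).2.1, fun c hc => (hUsub hc).2.2,
      fun c hc c' hc' => h (show (c, c') ∈ U₁ ×ˢ U₂ from ⟨(hUsub hc).1.1, (hUsub hc').1.2⟩)⟩
  -- the slice meets each coset at most once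
  have key : ∀ c ∈ U, ∀ c' ∈ U, ∀ h ∈ S.toSubgroup, σ c * h = σ c' → c = c' := by
    intro c hc c' hc' h hh heq
    have : h = (σ c)⁻¹ * σ c' := by rw [← heq]; group
    obtain ⟨b, hb, hbh⟩ := hO₁B h hh (this ▸ hUO₁ c hc c' hc')
    have h1 : Ψ (b, c) = Ψ (0, c') := by
      simp only [Ψ, m, hbh, heq, hτ0, mul_one]
    have h2 : ((b, c) : EB × S.Normal) = (0, c') := P.injOn (hBU₀ ⟨hb.1, hUU₀ hc⟩) (hBU₀ ⟨h0B, hUU₀ hc'⟩)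
      (by rw [hPΨ, hPΨ, h1])
    exact (Prod.ext_iff.1 h2).2
  have key' : ∀ c ∈ U, ∀ c' ∈ U, ∀ h ∈ S.toSubgroup, ∀ h' ∈ S.toSubgroup,
      σ c * h = σ c' * h' → c = c' := by
    intro c hc c' hc' h hh h' hh' heq
    refine key c hc c' hc' (h * h'⁻¹) (mul_mem hh (inv_mem hh')) ?_
    rw [← mul_assoc, heq]; group
  classical
  let r : GA → S.Normal := fun g =>
    if hg : ∃ c ∈ U, ∃ h ∈ S.toSubgroup, g = σ c * h then hg.choose else 0
  have hr : ∀ c ∈ U, ∀ h ∈ S.toSubgroup, r (σ c * h) = c := by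
    intro c hc h hh
    have hg : ∃ c' ∈ U, ∃ h' ∈ S.toSubgroup, σ c * h = σ c' * h' := ⟨c, hc, h, hh, rfl⟩
    simp only [r, dif_pos hg]
    obtain ⟨hc', h', hh', heq⟩ := hg.choose_spec
    exact (key' c hc _ hc' h hh h' hh' heq).symm
  -- the open set of the `σ c * τ b`
  let A : Set GA := φ.source ∩ φ ⁻¹' (P '' (B₁ ×ˢ U))
  have hsub : B₁ ×ˢ U ⊆ P.source := (Set.prod_mono inter_subset_left hUU₀).trans hBU₀
  have hA : IsOpen A := φ.continuousOn.isOpen_inter_preimage φ.open_source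
    (P.isOpen_image_of_subset_source (hB₁.prod hU) hsub)
  have hAσ : ∀ c ∈ U, σ c ∈ A := by
    intro c hc
    have h2 : m (0, c) = σ c := by simp [m, hτ0]
    have h3 : m (0, c) ∈ φ.source := (hPO (hsub (show ((0 : EB), c) ∈ B₁ ×ˢ U from ⟨h0B₁, hc⟩))).2
    refine ⟨h2 ▸ h3, (0, c), ⟨h0B₁, hc⟩, ?_⟩
    rw [hPΨ]
    simp only [Ψ, h2]
  have hAm : ∀ g ∈ A, ∃ b ∈ B₁, ∃ c ∈ U, g = σ c * τ b ∧ (P.symm (φ g)) = (b, c) := by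
    rintro g ⟨hg, ⟨b, c⟩, ⟨hb, hc⟩, hbc⟩
    refine ⟨b, hb, c, hc, ?_, ?_⟩
    · rw [hPΨ] at hbc
      exact (φ.injOn (hPO (hsub (show (b, c) ∈ B₁ ×ˢ U from ⟨hb, hc⟩))).2 hg hbc).symm
    · rw [← hbc, P.left_inv (hsub ⟨hb, hc⟩)]
  have hτS : ∀ b ∈ B₁, τ b ∈ S.toSubgroup := fun b hb => by
    rw [hτd b hb.2]; exact SetLike.coe_mem _
  have hAr : ∀ g, ∀ h ∈ S.toSubgroup, g * h⁻¹ ∈ A →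
      (∃ c ∈ U, ∃ h ∈ S.toSubgroup, g = σ c * h) ∧ r g = (P.symm (φ (g * h⁻¹))).2 := by
    intro g h hh hg
    obtain ⟨b, hb, c, hc, h1, h2⟩ := hAm _ hg
    have h3 : g = σ c * (τ b * h) := by
      rw [← mul_assoc, ← h1]; group
    have h4 : τ b * h ∈ S.toSubgroup := mul_mem (hτS b hb) hh
    refine ⟨⟨c, hc, _, h4, h3⟩, ?_⟩
    rw [h2]
    conv_lhs => rw [h3]
    exact hr c hc _ h4
  have hnhd : ∀ c ∈ U, ∀ h ∈ S.toSubgroup, (fun g => g * h⁻¹) ⁻¹' A ∈ 𝓝 (σ c * h) := by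
    intro c hc h hh
    refine (hA.preimage (by fun_prop)).mem_nhds ?_
    simpa using hAσ c hc
  refine ⟨⟨U, σ, r, hU, h0U, hσ0, hσ.mono hUσ', ?_, ?_, hr⟩⟩
  · rw [isOpen_iff_mem_nhds]
    rintro _ ⟨c, hc, h, hh, rfl⟩
    filter_upwards [hnhd c hc h hh] with g hg
    exact (hAr g h hh hg).1
  · rintro _ ⟨c, hc, h, hh, rfl⟩
    refine ContMDiffAt.contMDiffWithinAt ?_
    have heq : r =ᶠ[𝓝 (σ c * h)] fun g => (P.symm (φ (g * h⁻¹))).2 := by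
      filter_upwards [hnhd c hc h hh] with g hg
      exact (hAr g h hh hg).2
    refine ContMDiffAt.congr_of_eventuallyEq ?_ heq
    have hσA := hAσ c hc
    have s1 : ContMDiffAt 𝓘(ℝ, EA) 𝓘(ℝ, EA) ∞ (fun g : GA => g * h⁻¹) (σ c * h) :=
      contMDiff_mul_right.contMDiffAt
    have s2 : ContMDiffAt 𝓘(ℝ, EA) 𝓘(ℝ, EA) ∞ φ (σ c) :=
      hφ'.contMDiffAt (φ.open_source.mem_nhds hσA.1)
    have hPt : φ (σ c) ∈ P.target := by
      obtain ⟨p, hp, hpe⟩ := hσA.2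
      rw [← hpe]
      exact P.map_source (hsub hp)
    have s3 : ContMDiffAt 𝓘(ℝ, EA) 𝓘(ℝ, EB × S.Normal) ∞ P.symm (φ (σ c)) :=
      (hPs.contDiffAt (P.open_target.mem_nhds hPt)).contMDiffAt
    have s4 : ContMDiffAt 𝓘(ℝ, EA) 𝓘(ℝ, S.Normal) ∞ (fun y => (P.symm y).2) (φ (σ c)) :=
      contDiff_snd.contMDiff.contMDiffAt.comp _ s3
    have e1 : σ c * h * h⁻¹ = σ c := by group
    exact (s4.comp (σ c) s2).comp_of_eq s1 e1

/-- A smooth slice, chosen once and for all. -/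
def slice [CompleteSpace EA] [LieGroup 𝓘(ℝ, EA) ∞ GA] : S.Slice :=
  Classical.choice S.nonempty_slice

/-- The homogeneous space `G_A / G_B`, with the quotient topology. -/
def Base : Type _ := GA ⧸ S.toSubgroup

instance : TopologicalSpace S.Base := inferInstanceAs (TopologicalSpace (GA ⧸ S.toSubgroup))

/-- The projection `g ↦ g G_B`. -/
def coset (g : GA) : S.Base := QuotientGroup.mk g

theorem coset_eq_iff {g g' : GA} : S.coset g = S.coset g' ↔ g⁻¹ * g' ∈ S.toSubgroup :=
  QuotientGroup.eq

theorem isOpenQuotientMap_coset [LieGroup 𝓘(ℝ, EA) ∞ GA] : IsOpenQuotientMap S.coset :=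
  have : IsTopologicalGroup GA := topologicalGroup_of_lieGroup 𝓘(ℝ, EA) ∞
  QuotientGroup.isOpenQuotientMap_mk

namespace Slice

variable {S} (T : S.Slice)

/-- The open set `σ(U) G_B`. -/
def W : Set GA := {g : GA | ∃ c ∈ T.U, ∃ h ∈ S.toSubgroup, g = T.σ c * h}

theorem σ_mem {c : S.Normal} (hc : c ∈ T.U) : T.σ c ∈ T.W := ⟨c, hc, 1, one_mem _, by simp⟩

theorem r_σ {c : S.Normal} (hc : c ∈ T.U) : T.r (T.σ c) = c := by
  simpa using T.r_eq c hc 1 (one_mem _)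

theorem r_mem {g : GA} (hg : g ∈ T.W) : T.r g ∈ T.U := by
  obtain ⟨c, hc, h, hh, rfl⟩ := hg
  rwa [T.r_eq c hc h hh]

theorem inv_σ_r_mul_mem {g : GA} (hg : g ∈ T.W) : (T.σ (T.r g))⁻¹ * g ∈ S.toSubgroup := by
  obtain ⟨c, hc, h, hh, rfl⟩ := hg
  rw [T.r_eq c hc h hh]
  simpa using hh

theorem mul_mem_W {g h : GA} (hg : g ∈ T.W) (hh : h ∈ S.toSubgroup) :
    g * h ∈ T.W ∧ T.r (g * h) = T.r g := by
  obtain ⟨c, hc, h', hh', rfl⟩ := hg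
  rw [mul_assoc, T.r_eq c hc h' hh', T.r_eq c hc _ (mul_mem hh' hh)]
  exact ⟨⟨c, hc, _, mul_mem hh' hh, rfl⟩, rfl⟩

open Classical in
/-- The component `h` in the subgroup of an element `g = σ(c) h` of `σ(U) G_B`. -/
def fib (g : GA) : S.toSubgroup :=
  if hg : (T.σ (T.r g))⁻¹ * g ∈ S.toSubgroup then ⟨_, hg⟩ else 1

theorem coe_fib {g : GA} (hg : g ∈ T.W) : (T.fib g : GA) = (T.σ (T.r g))⁻¹ * g := by
  rw [fib, dif_pos (T.inv_σ_r_mul_mem hg)]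

theorem continuousOn_fib [LieGroup 𝓘(ℝ, EA) ∞ GA] : ContinuousOn T.fib T.W := by
  have : IsTopologicalGroup GA := topologicalGroup_of_lieGroup 𝓘(ℝ, EA) ∞
  rw [IsInducing.subtypeVal.continuousOn_iff]
  have h1 : ContinuousOn (fun g => (T.σ (T.r g))⁻¹ * g) T.W :=
    (T.smooth_σ.continuousOn.comp T.smooth_r.continuousOn
      (fun g hg => T.r_mem hg)).inv.mul continuousOn_id
  exact h1.congr (fun g hg => T.coe_fib hg)

end Slice

section Complete

variable [CompleteSpace EA] [LieGroup 𝓘(ℝ, EA) ∞ GA]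

/-- The chart of `G_A / G_B` around `g₀ G_B` whose inverse is `c ↦ g₀ σ(c) G_B`. -/
def baseChart (g₀ : GA) : OpenPartialHomeomorph S.Base S.Normal :=
  have tg : IsTopologicalGroup GA := topologicalGroup_of_lieGroup 𝓘(ℝ, EA) ∞
  chartOfSlice S.coset S.isOpenQuotientMap_coset ((fun g => g₀⁻¹ * g) ⁻¹' S.slice.W) S.slice.U
    (fun c => g₀ * S.slice.σ c) (fun g => S.slice.r (g₀⁻¹ * g))
    (S.slice.isOpen_W.preimage (by fun_prop)) S.slice.isOpen_U
    (continuousOn_const.mul S.slice.smooth_σ.continuousOn)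
    (S.slice.smooth_r.continuousOn.comp (by fun_prop) (fun g hg => hg))
    (fun c hc => by simpa using S.slice.σ_mem hc)
    (fun g hg => S.slice.r_mem hg)
    (fun c hc => by simpa using S.slice.r_σ hc)
    (fun g hg => by
      rw [coset_eq_iff]
      simpa [mul_assoc] using S.slice.inv_σ_r_mul_mem hg)
    (fun g hg g' h => by
      have := (S.slice.mul_mem_W hg (S.coset_eq_iff.1 h)).2
      simpa [mul_assoc] using this)

/-- The canonical Banach manifold structure of `G_A / G_B`. -/
instance : ChartedSpace S.Normal S.Base where
  atlas := range S.baseChart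
  chartAt x := S.baseChart (surjInv S.isOpenQuotientMap_coset.surjective x)
  mem_chart_source x := by
    refine ⟨surjInv S.isOpenQuotientMap_coset.surjective x, ?_, surjInv_eq _ x⟩
    simpa [S.slice.σ_zero] using S.slice.σ_mem S.slice.zero_mem
  chart_mem_atlas x := mem_range_self _

end Complete

section Bundle

variable {F : Type*} [NormedAddCommGroup F] [NormedSpace ℂ F]

/-- The relation `(g, f) ∼ (g w, ρ(w⁻¹) f)`, `w ∈ G_B`, on `G_A × F`. -/
def bundleSetoid (ρ : S.toSubgroup →ₜ* (F →L[ℂ] F)) : Setoid (GA × F) where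
  r p p' := ∃ w : S.toSubgroup, p'.1 = p.1 * w ∧ p'.2 = ρ w⁻¹ p.2
  iseqv :=
    { refl := fun p => ⟨1, by simp⟩
      symm := by
        rintro ⟨g, f⟩ ⟨g', f'⟩ ⟨w, h1, h2⟩
        dsimp only at h1 h2
        subst h1 h2
        refine ⟨w⁻¹, by simp, ?_⟩
        rw [← mul_apply_eq_comp, ← map_mul]
        simp
      trans := by
        rintro ⟨g, f⟩ ⟨g', f'⟩ ⟨g'', f''⟩ ⟨w, h1, h2⟩ ⟨w', h3, h4⟩
        dsimp only at h1 h2 h3 h4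
        subst h1 h2 h3 h4
        refine ⟨w * w', by simp [mul_assoc], ?_⟩
        rw [← mul_apply_eq_comp, ← map_mul, mul_inv_rev] }

/-- The total space `D = G_A ×_{G_B} F` of the homogeneous vector bundle induced by a
norm-continuous representation `ρ` of `G_B` on `F`. -/
def HomogeneousBundle (ρ : S.toSubgroup →ₜ* (F →L[ℂ] F)) : Type _ := Quotient (S.bundleSetoid ρ)

variable (ρ : S.toSubgroup →ₜ* (F →L[ℂ] F))

instance : TopologicalSpace (S.HomogeneousBundle ρ) :=
  inferInstanceAs (TopologicalSpace (Quotient (S.bundleSetoid ρ)))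

/-- The class `[(g, f)]`. -/
def cls (p : GA × F) : S.HomogeneousBundle ρ := Quotient.mk (S.bundleSetoid ρ) p

theorem cls_eq_iff {p p' : GA × F} : S.cls ρ p = S.cls ρ p' ↔
    ∃ w : S.toSubgroup, p'.1 = p.1 * w ∧ p'.2 = ρ w⁻¹ p.2 :=
  Quotient.eq (r := S.bundleSetoid ρ)

/-- The bundle projection `Π : [(g, f)] ↦ g G_B`. -/
def proj : S.HomogeneousBundle ρ → S.Base :=
  Quotient.lift (fun p : GA × F => S.coset p.1) (by
    rintro p p' ⟨w, h1, -⟩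
    rw [coset_eq_iff, h1]
    simp)

theorem isOpenQuotientMap_cls [LieGroup 𝓘(ℝ, EA) ∞ GA] : IsOpenQuotientMap (S.cls ρ) := by
  have : IsTopologicalGroup GA := topologicalGroup_of_lieGroup 𝓘(ℝ, EA) ∞
  refine ⟨Quotient.mk_surjective, continuous_quotient_mk', ?_⟩
  intro O hO
  have h : S.cls ρ ⁻¹' (S.cls ρ '' O) =
      ⋃ w : S.toSubgroup, (fun p : GA × F => (p.1 * w, ρ w⁻¹ p.2)) ⁻¹' O := by
    ext p
    simp only [mem_preimage, mem_image, mem_iUnion]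
    constructor
    · rintro ⟨p', hp', h⟩
      obtain ⟨w, h1, h2⟩ := (S.cls_eq_iff ρ).1 h.symm
      exact ⟨w, by rwa [← h1, ← h2]⟩
    · rintro ⟨w, hw⟩
      exact ⟨_, hw, ((S.cls_eq_iff ρ).2 ⟨w, rfl, rfl⟩).symm⟩
  have h' : IsOpen (S.cls ρ ⁻¹' (S.cls ρ '' O)) := by
    rw [h]
    exact isOpen_iUnion fun w => hO.preimage (by fun_prop)
  exact h'

variable [CompleteSpace EA] [LieGroup 𝓘(ℝ, EA) ∞ GA]

/-- The chart of `D` whose inverse is `(c, f) ↦ [(g₀ σ(c), f)]`. -/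
def bundleChart (g₀ : GA) : OpenPartialHomeomorph (S.HomogeneousBundle ρ) (S.Normal × F) :=
  have tg : IsTopologicalGroup GA := topologicalGroup_of_lieGroup 𝓘(ℝ, EA) ∞
  have hfst : ContinuousOn (fun p : GA × F => g₀⁻¹ * p.1)
      ((fun p : GA × F => g₀⁻¹ * p.1) ⁻¹' S.slice.W) := by fun_prop
  chartOfSlice (S.cls ρ) (S.isOpenQuotientMap_cls ρ)
    ((fun p : GA × F => g₀⁻¹ * p.1) ⁻¹' S.slice.W) (S.slice.U ×ˢ univ)
    (fun x => (g₀ * S.slice.σ x.1, x.2))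
    (fun p => (S.slice.r (g₀⁻¹ * p.1), ρ (S.slice.fib (g₀⁻¹ * p.1)) p.2))
    (S.slice.isOpen_W.preimage (by fun_prop)) (S.slice.isOpen_U.prod isOpen_univ)
    ((continuousOn_const.mul (S.slice.smooth_σ.continuousOn.comp continuousOn_fst
      (fun x hx => hx.1))).prodMk continuousOn_snd)
    ((S.slice.smooth_r.continuousOn.comp hfst (fun g hg => hg)).prodMk
      ((ρ.continuous_toFun.comp_continuousOn
        (S.slice.continuousOn_fib.comp hfst (fun g hg => hg))).clm_apply continuousOn_snd))
    (fun x hx => by simpa using S.slice.σ_mem hx.1)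
    (fun p hp => ⟨S.slice.r_mem hp, mem_univ _⟩)
    (fun x hx => by
      have h1 : S.slice.fib (S.slice.σ x.1) = 1 := by
        ext
        rw [S.slice.coe_fib (S.slice.σ_mem hx.1), S.slice.r_σ hx.1]
        simp
      ext <;> simp [S.slice.r_σ hx.1, h1])
    (fun p hp => by
      rw [cls_eq_iff]
      refine ⟨S.slice.fib (g₀⁻¹ * p.1), ?_, ?_⟩
      · dsimp only
        rw [S.slice.coe_fib hp]
        group
      · dsimp only
        rw [← mul_apply_eq_comp, ← map_mul]
        simp)
    (fun p hp p' h => by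
      obtain ⟨w, h1, h2⟩ := (S.cls_eq_iff ρ).1 h
      have h3 := S.slice.mul_mem_W hp w.2
      have h4 : g₀⁻¹ * p'.1 = g₀⁻¹ * p.1 * w := by rw [h1, mul_assoc]
      have h5 : S.slice.fib (g₀⁻¹ * p'.1) = S.slice.fib (g₀⁻¹ * p.1) * w := by
        ext
        rw [Subgroup.coe_mul, S.slice.coe_fib hp, h4, S.slice.coe_fib h3.1, h3.2]
        simp only [mul_assoc]
      ext1
      · dsimp only
        rw [h4, h3.2]
      · dsimp only
        rw [h5, h2, ← mul_apply_eq_comp, ← map_mul]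
        simp)

/-- The canonical Banach manifold structure of `D = G_A ×_{G_B} F`. -/
instance : ChartedSpace (S.Normal × F) (S.HomogeneousBundle ρ) where
  atlas := range (S.bundleChart ρ)
  chartAt x := S.bundleChart ρ (surjInv (S.isOpenQuotientMap_cls ρ).surjective x).1
  mem_chart_source x := by
    refine ⟨surjInv (S.isOpenQuotientMap_cls ρ).surjective x, ?_, surjInv_eq _ x⟩
    simpa [S.slice.σ_zero] using S.slice.σ_mem S.slice.zero_mem
  chart_mem_atlas x := mem_range_self _

/-- The tangent vector `[((g, X), (f, h))]` of `D` at `[(g, f)]`: the image, under the tangent map of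
`(g, f) ↦ [(g, f)]`, of the tangent vector of `G_A × F` at `(g, f)` with components `T_1(λ_g) X`
(where `λ_g` is the left translation by `g`) and `h`. -/
def tangentCls (p : (GA × GroupLieAlgebra 𝓘(ℝ, EA) GA) × (F × F)) :
    TangentBundle 𝓘(ℝ, S.Normal × F) (S.HomogeneousBundle ρ) :=
  tangentMap (𝓘(ℝ, EA).prod 𝓘(ℝ, F)) 𝓘(ℝ, S.Normal × F) (S.cls ρ)
    ⟨(p.1.1, p.2.1), (mulInvariantVectorField p.1.2 p.1.1, p.2.2)⟩

end Bundle

end BanachLieSubgroup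

/-- The adjoint action `Ad(g) = T_1(x ↦ g x g⁻¹)` of a Banach--Lie group on its Lie algebra. -/
def lieAd {EA GA : Type*} [NormedAddCommGroup EA] [NormedSpace ℝ EA]
    [TopologicalSpace GA] [ChartedSpace EA GA] [Group GA] (g : GA) :
    GroupLieAlgebra 𝓘(ℝ, EA) GA →L[ℝ] GroupLieAlgebra 𝓘(ℝ, EA) GA :=
  (mfderiv 𝓘(ℝ, EA) 𝓘(ℝ, EA) (fun x : GA => g * x * g⁻¹) 1 : EA →L[ℝ] EA)

/-- The derivative `dα = T_1 α` of a homomorphism of Banach--Lie groups. -/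
def lieDerived {EA GA EA' GA' : Type*} [NormedAddCommGroup EA] [NormedSpace ℝ EA]
    [TopologicalSpace GA] [ChartedSpace EA GA] [Group GA]
    [NormedAddCommGroup EA'] [NormedSpace ℝ EA']
    [TopologicalSpace GA'] [ChartedSpace EA' GA'] [Group GA']
    (α : ContMDiffMonoidMorphism 𝓘(ℝ, EA) 𝓘(ℝ, EA') ∞ GA GA') :
    GroupLieAlgebra 𝓘(ℝ, EA) GA →L[ℝ] GroupLieAlgebra 𝓘(ℝ, EA') GA' :=
  (mfderiv 𝓘(ℝ, EA) 𝓘(ℝ, EA') α 1 : EA →L[ℝ] EA')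

/-- The Lie algebra `𝔤_B` of a Banach--Lie subgroup, as a subspace of `𝔤_A`. -/
def BanachLieSubgroup.lieSubalgebra {EA EB GA : Type*}
    [NormedAddCommGroup EA] [NormedSpace ℝ EA] [NormedAddCommGroup EB] [NormedSpace ℝ EB]
    [TopologicalSpace GA] [ChartedSpace EA GA] [Group GA] (S : BanachLieSubgroup EA EB GA) :
    Submodule ℝ (GroupLieAlgebra 𝓘(ℝ, EA) GA) :=
  LinearMap.range
    (mfderiv 𝓘(ℝ, EB) 𝓘(ℝ, EA) (Subtype.val : S.toSubgroup → GA) 1).toLinearMap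

/-- A reductive structure `(G_A, G_B; E)`: `E` is a continuous projection of `𝔤_A` onto `𝔤_B` which
commutes with `Ad(g)` for all `g` in `G_B`. -/
structure ReductiveStructure (EA EB GA : Type*)
    [NormedAddCommGroup EA] [NormedSpace ℝ EA] [NormedAddCommGroup EB] [NormedSpace ℝ EB]
    [TopologicalSpace GA] [ChartedSpace EA GA] [Group GA] extends
    BanachLieSubgroup EA EB GA where
  E : GroupLieAlgebra 𝓘(ℝ, EA) GA →L[ℝ] GroupLieAlgebra 𝓘(ℝ, EA) GA
  E_comp_E : E ∘L E = E
  range_E : LinearMap.range E.toLinearMap = toBanachLieSubgroup.lieSubalgebra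
  E_comp_ad : ∀ g ∈ toSubgroup, E ∘L lieAd g = lieAd g ∘L E

/-- A morphism of reductive structures: a smooth homomorphism `α` with `α(G_B) ⊆ G̃_B` and
`dα ∘ E = Ẽ ∘ dα`. -/
structure ReductiveStructure.Hom {EA EB GA EA' EB' GA' : Type*}
    [NormedAddCommGroup EA] [NormedSpace ℝ EA] [NormedAddCommGroup EB] [NormedSpace ℝ EB]
    [TopologicalSpace GA] [ChartedSpace EA GA] [Group GA]
    [NormedAddCommGroup EA'] [NormedSpace ℝ EA'] [NormedAddCommGroup EB'] [NormedSpace ℝ EB']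
    [TopologicalSpace GA'] [ChartedSpace EA' GA'] [Group GA']
    (R : ReductiveStructure EA EB GA) (R' : ReductiveStructure EA' EB' GA') extends
    ContMDiffMonoidMorphism 𝓘(ℝ, EA) 𝓘(ℝ, EA') ∞ GA GA' where
  map_mem : ∀ g ∈ R.toSubgroup, toFun g ∈ R'.toSubgroup
  derived_comp_E : lieDerived toContMDiffMonoidMorphism ∘L R.E =
    R'.E ∘L lieDerived toContMDiffMonoidMorphism

namespace ReductiveStructure

variable {EA EB GA EA' EB' GA' F : Type*}
  [NormedAddCommGroup EA] [NormedSpace ℝ EA] [NormedAddCommGroup EB] [NormedSpace ℝ EB]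
  [TopologicalSpace GA] [ChartedSpace EA GA] [Group GA]
  [NormedAddCommGroup EA'] [NormedSpace ℝ EA'] [NormedAddCommGroup EB'] [NormedSpace ℝ EB']
  [TopologicalSpace GA'] [ChartedSpace EA' GA'] [Group GA']
  [NormedAddCommGroup F] [NormedSpace ℂ F]

section Connection

variable [CompleteSpace EA] [LieGroup 𝓘(ℝ, EA) ∞ GA]
  (R : ReductiveStructure EA EB GA) (ρ : R.toSubgroup →ₜ* (F →L[ℂ] F))

/-- `Φ : TD → TD` is the map `[((g, X), (f, h))] ↦ [((g, E X), (f, h))]` (and every tangent vector of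
`D` is of the form `[((g, X), (f, h))]`). -/
def IsInducedMap (Φ : TangentBundle 𝓘(ℝ, R.Normal × F) (R.HomogeneousBundle ρ) →
    TangentBundle 𝓘(ℝ, R.Normal × F) (R.HomogeneousBundle ρ)) : Prop :=
  Surjective (R.tangentCls ρ) ∧
    ∀ g X f h, Φ (R.tangentCls ρ ((g, X), (f, h))) = R.tangentCls ρ ((g, R.E X), (f, h))

/-- The connection `Φ_E : TD → TD` induced by the reductive structure,
`[((g, X), (f, h))] ↦ [((g, E X), (f, h))]`. -/
def connection : TangentBundle 𝓘(ℝ, R.Normal × F) (R.HomogeneousBundle ρ) →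
    TangentBundle 𝓘(ℝ, R.Normal × F) (R.HomogeneousBundle ρ) :=
  extend (R.tangentCls ρ) (fun p => R.tangentCls ρ ((p.1.1, R.E p.1.2), p.2)) id

end Connection

namespace Hom

variable {R : ReductiveStructure EA EB GA} {R' : ReductiveStructure EA' EB' GA'} (α : R.Hom R')

/-- The restriction `α|_{G_B} : G_B → G̃_B`. -/
def restrict : R.toSubgroup →ₜ* R'.toSubgroup where
  toFun g := ⟨α.toFun g, α.map_mem g g.2⟩
  map_one' := Subtype.ext (by simp)
  map_mul' g h := Subtype.ext (by simp)
  continuous_toFun :=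
    (α.contMDiff_toFun.continuous.comp continuous_subtype_val).subtype_mk _

variable (ρ' : R'.toSubgroup →ₜ* (F →L[ℂ] F))

/-- The representation `ρ = ρ̃ ∘ α|_{G_B}`. -/
def pullRep : R.toSubgroup →ₜ* (F →L[ℂ] F) := ρ'.comp α.restrict

/-- `ζ : g G_B ↦ α(g) G̃_B`. -/
def baseMap : R.Base → R'.Base :=
  Quotient.lift (fun g : GA => R'.coset (α.toFun g)) (by
    intro g g' h
    have h' : g⁻¹ * g' ∈ R.toSubgroup := QuotientGroup.leftRel_apply.1 h
    rw [BanachLieSubgroup.coset_eq_iff]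
    have := α.map_mem _ h'
    simpa using this)

/-- `δ : [(g, f)] ↦ [(α(g), f)]`. -/
def bundleMap : R.HomogeneousBundle (α.pullRep ρ') → R'.HomogeneousBundle ρ' :=
  Quotient.lift (fun p : GA × F => R'.cls ρ' (α.toFun p.1, p.2)) (by
    rintro p p' ⟨w, h1, h2⟩
    rw [BanachLieSubgroup.cls_eq_iff]
    refine ⟨α.restrict w, ?_, ?_⟩
    · dsimp only
      rw [h1]
      exact map_mul α.toMonoidHom p.1 w
    · dsimp only
      rw [h2, ← map_inv]
      rfl)

end Hom

end ReductiveStructure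

section Connections

variable {EM EZ EM' EZ' M Z M' Z' : Type*}
  [NormedAddCommGroup EM] [NormedSpace ℝ EM] [TopologicalSpace M] [ChartedSpace EM M]
  [NormedAddCommGroup EZ] [NormedSpace ℝ EZ] [TopologicalSpace Z] [ChartedSpace EZ Z]
  [NormedAddCommGroup EM'] [NormedSpace ℝ EM'] [TopologicalSpace M'] [ChartedSpace EM' M']
  [NormedAddCommGroup EZ'] [NormedSpace ℝ EZ'] [TopologicalSpace Z'] [ChartedSpace EZ' Z']

/-- `Φ : TM → TM` is a connection on the bundle `φ : M → Z`. -/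
structure IsConnection [IsManifold 𝓘(ℝ, EM) ∞ M] (φ : M → Z)
    (Φ : TangentBundle 𝓘(ℝ, EM) M → TangentBundle 𝓘(ℝ, EM) M) : Prop where
  smooth : ContMDiff 𝓘(ℝ, EM).tangent 𝓘(ℝ, EM).tangent ∞ Φ
  idem : Φ ∘ Φ = Φ
  fiberwise : ∀ x : M, ∃ L : TangentSpace 𝓘(ℝ, EM) x →L[ℝ] TangentSpace 𝓘(ℝ, EM) x,
    (∀ v, Φ ⟨x, v⟩ = ⟨x, L v⟩) ∧
      LinearMap.range L.toLinearMap = LinearMap.ker (mfderiv 𝓘(ℝ, EM) 𝓘(ℝ, EZ) φ x).toLinearMap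

/-- `(δ, ζ)` is a homomorphism from the bundle `φ : M → Z` to the bundle `φ' : M' → Z'` which maps
each fibre of `φ` diffeomorphically onto a fibre of `φ'`. (A map on a fibre, which is a split
submanifold of the total space, is smooth iff it is smooth as a map on that subset.) -/
structure IsFiberwiseDiffeoBundleHom (EM EZ EM' EZ' : Type*)
    [NormedAddCommGroup EM] [NormedSpace ℝ EM] [ChartedSpace EM M]
    [NormedAddCommGroup EZ] [NormedSpace ℝ EZ] [ChartedSpace EZ Z]
    [NormedAddCommGroup EM'] [NormedSpace ℝ EM'] [ChartedSpace EM' M']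
    [NormedAddCommGroup EZ'] [NormedSpace ℝ EZ'] [ChartedSpace EZ' Z']
    (φ : M → Z) (φ' : M' → Z') (δ : M → M') (ζ : Z → Z') : Prop where
  smooth_proj : ContMDiff 𝓘(ℝ, EM) 𝓘(ℝ, EZ) ∞ φ
  smooth_proj' : ContMDiff 𝓘(ℝ, EM') 𝓘(ℝ, EZ') ∞ φ'
  smooth_total : ContMDiff 𝓘(ℝ, EM) 𝓘(ℝ, EM') ∞ δ
  smooth_base : ContMDiff 𝓘(ℝ, EZ) 𝓘(ℝ, EZ') ∞ ζ
  comm : φ' ∘ δ = ζ ∘ φ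
  fiber_bijOn : ∀ s : Z, BijOn δ (φ ⁻¹' {s}) (φ' ⁻¹' {ζ s})
  fiber_smooth_inv : ∀ s : Z, ∃ κ : M' → M, LeftInvOn κ δ (φ ⁻¹' {s}) ∧
    ContMDiffOn 𝓘(ℝ, EM') 𝓘(ℝ, EM) ∞ κ (φ' ⁻¹' {ζ s})

/-- `Φ` is the pull-back `Θ^*(Φ')` of the connection `Φ'` through the fibrewise diffeomorphic bundle
homomorphism `Θ = (δ, ζ)`: the unique connection with `Tδ ∘ Φ = Φ' ∘ Tδ`. -/
structure IsPullbackConnection [IsManifold 𝓘(ℝ, EM) ∞ M] [IsManifold 𝓘(ℝ, EM') ∞ M']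
    (φ : M → Z) (φ' : M' → Z') (δ : M → M') (ζ : Z → Z')
    (Φ' : TangentBundle 𝓘(ℝ, EM') M' → TangentBundle 𝓘(ℝ, EM') M')
    (Φ : TangentBundle 𝓘(ℝ, EM) M → TangentBundle 𝓘(ℝ, EM) M) : Prop where
  hom : IsFiberwiseDiffeoBundleHom EM EZ EM' EZ' φ φ' δ ζ
  connection_target : IsConnection (EZ := EZ') φ' Φ'
  connection : IsConnection (EZ := EZ) φ Φ
  comm : tangentMap 𝓘(ℝ, EM) 𝓘(ℝ, EM') δ ∘ Φ = Φ' ∘ tangentMap 𝓘(ℝ, EM) 𝓘(ℝ, EM') δ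
  unique : ∀ Ψ, IsConnection (EZ := EZ) φ Ψ →
    tangentMap 𝓘(ℝ, EM) 𝓘(ℝ, EM') δ ∘ Ψ = Φ' ∘ tangentMap 𝓘(ℝ, EM) 𝓘(ℝ, EM') δ → Ψ = Φ

end Connections

end

set_option linter.unusedSectionVars false

/-! In the left trivialization, write `L` for the derivative at `(1, f)` of `(x, k) ↦ [(g x, k)]`,
so that `[((g, X), (f, h))]` is the vector `L (X, h)` at `[(g, f)]`. Three facts about `L` carry the
argument. It has a continuous right inverse, the derivative of a local section of the quotient map.
The vector `L (X, h)` is vertical exactly when `X` lies in `𝔤_B`. Replacing `g` by `g w` with `w` in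
`G_B` acts by `Ad(w)` on `X` and by `ρ w` on `f` and `h` (`tangentCls_mul`).

The induced map is then well defined: `E` commutes with `Ad(w)`, and if `L (Y, k) = 0` then `Y` lies
in `𝔤_B`, so `E Y = Y` and `L (E Y, k) = 0`. It is idempotent because `E` is, and its range on each
tangent space is the vertical space because the range of `E` is `𝔤_B`. A homomorphism satisfies `α(g
x) = α(g) α(x)`, so `Tδ` sends `((g, X), (f, h))` to `((α(g), dα X), (f, h))`, and `dα ∘ E = Ẽ ∘ dα`
gives the intertwining relation. For uniqueness, any two connections with this relation take
vertical values with the same image under `Tδ`. A vertical vector has the form `L (0, k)`, and `Tδ`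
keeps `k`, hence is injective on vertical vectors.

The analytic work is smoothness. The manifold structure of `D` requires the representation to be
smooth, although only its norm continuity is assumed. The passage from continuity to
differentiability at `1` rests on `exists_bound_of_doubling` (a linear bound for `ρ - 1`) and
`exists_hasFDerivAt_zero_of_approx_additive` (a derivative as a limit of dyadic rescalings); the
differential equation satisfied by `ρ` then gives all derivatives. Smoothness of the connection is
read off from its formula in a bundle chart, `exists_connection_in_chart`, whose coefficient is the
left logarithmic derivative of the slice. -/

noncomputable section

/-! ### Differentiability at a point from approximate functional equations -/

section Analytic

open Filter

/-- The Hyers–Ulam construction: the rescalings `2 ^ n • f (2⁻ⁿ • x)` converge since doubling costs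
only a quadratic error. Their limit is additive and bounded, hence linear, and differs from `f` near
`0` by `O(‖x‖²)`. -/
theorem exists_hasFDerivAt_zero_of_approx_additive {X Y : Type*} [NormedAddCommGroup X]
    [NormedSpace ℝ X] [NormedAddCommGroup Y] [NormedSpace ℝ Y] [CompleteSpace Y] {f : X → Y}
    {K C : ℝ} (hf : ∀ᶠ x in 𝓝 (0 : X), ‖f x‖ ≤ K * ‖x‖)
    (hadd : ∀ᶠ p in 𝓝 ((0, 0) : X × X),
      ‖f (p.1 + p.2) - f p.1 - f p.2‖ ≤ C * (‖p.1‖ + ‖p.2‖) ^ 2) :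
    ∃ L : X →L[ℝ] Y, HasFDerivAt f L 0 := by
  obtain ⟨r, hr, hf, hadd⟩ : ∃ r > 0, (∀ x, ‖x‖ < r → ‖f x‖ ≤ K * ‖x‖) ∧
      ∀ x y, ‖x‖ < r → ‖y‖ < r → ‖f (x + y) - f x - f y‖ ≤ C * (‖x‖ + ‖y‖) ^ 2 := by
    obtain ⟨r₁, hr₁, h₁⟩ := Metric.eventually_nhds_iff.1 hf
    obtain ⟨r₂, hr₂, h₂⟩ := Metric.eventually_nhds_iff.1 hadd
    refine ⟨min r₁ r₂, lt_min hr₁ hr₂, fun x hx => h₁ (by simpa using hx.trans_le (min_le_left _ _)),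
      fun x y hx hy => h₂ (y := (x, y)) ?_⟩
    rw [Prod.dist_eq]
    simpa using ⟨hx.trans_le (min_le_right _ _), hy.trans_le (min_le_right _ _)⟩
  let s : X → ℕ → Y := fun x n => (2 : ℝ) ^ n • f (((2 : ℝ) ^ n)⁻¹ • x)
  have hnorm : ∀ (x : X) (n : ℕ), ‖((2 : ℝ) ^ n)⁻¹ • x‖ = ‖x‖ / 2 ^ n := by
    intro x n
    rw [norm_smul, norm_inv, norm_pow, Real.norm_ofNat]
    field_simp
  have hsmall : ∀ x : X, ∀ᶠ n : ℕ in atTop, ‖((2 : ℝ) ^ n)⁻¹ • x‖ < r := by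
    intro x
    have : Tendsto (fun n : ℕ => ‖x‖ / (2 : ℝ) ^ n) atTop (𝓝 0) :=
      tendsto_const_nhds.div_atTop (tendsto_pow_atTop_atTop_of_one_lt (by norm_num))
    filter_upwards [this.eventually (gt_mem_nhds hr)] with n hn
    rwa [hnorm]
  -- The right side equals `C ‖x‖² / 2 ^ n`; it is written as `a / 2 / 2 ^ n` with `a = 2 C ‖x‖²`
  -- because the sum of that series is `a`.
  have hstep : ∀ x, ‖x‖ < r → ∀ n, dist (s x n) (s x (n + 1)) ≤ (2 * C * ‖x‖ ^ 2) / 2 / 2 ^ n := by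
    intro x hx n
    set y := ((2 : ℝ) ^ (n + 1))⁻¹ • x with hy
    have hyn : ‖y‖ = ‖x‖ / 2 ^ (n + 1) := hnorm x (n + 1)
    have hyr : ‖y‖ < r := by
      rw [hyn]
      exact (div_le_self (norm_nonneg x) (one_le_pow₀ (by norm_num))).trans_lt hx
    have hyy : ((2 : ℝ) ^ n)⁻¹ • x = y + y := by
      rw [← two_smul ℝ y, hy, smul_smul]
      congr 1
      rw [pow_succ]
      field_simp
    have h1 := hadd y y hyr hyr
    have h3 : s x n - s x (n + 1) = (2 : ℝ) ^ n • (f (y + y) - f y - f y) := by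
      simp only [s]
      rw [hyy, ← hy, pow_succ, mul_smul, two_smul, smul_sub, smul_sub, smul_add]
      abel
    rw [dist_eq_norm, h3, norm_smul, norm_pow, Real.norm_ofNat]
    calc (2 : ℝ) ^ n * ‖f (y + y) - f y - f y‖ ≤ 2 ^ n * (C * (‖y‖ + ‖y‖) ^ 2) := by gcongr
      _ = (2 * C * ‖x‖ ^ 2) / 2 / 2 ^ n := by
        rw [hyn, pow_succ]
        field_simp
        ring
  have hlim₀ : ∀ x, ‖x‖ < r → ∃ y, Tendsto (s x) atTop (𝓝 y) := fun x hx =>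
    cauchySeq_tendsto_of_complete (cauchySeq_of_le_geometric_two (hstep x hx))
  -- For large `x`, rescale into the ball: `s x (n + m) = 2 ^ m • s (2⁻ᵐ • x) n`.
  have hlim : ∀ x, ∃ y, Tendsto (s x) atTop (𝓝 y) := by
    intro x
    obtain ⟨m, hm⟩ := (hsmall x).exists
    obtain ⟨y, hy⟩ := hlim₀ _ hm
    refine ⟨(2 : ℝ) ^ m • y, (tendsto_add_atTop_iff_nat m).1 ?_⟩
    refine (hy.const_smul ((2 : ℝ) ^ m)).congr fun n => ?_
    simp only [s]
    rw [smul_smul, smul_smul, ← pow_add, add_comm m n]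
    congr 3
    rw [pow_add, mul_inv]
  choose l hl using hlim
  have hladd : ∀ x y, l (x + y) = l x + l y := by
    intro x y
    have hlim0 : Tendsto (fun n => s (x + y) n - s x n - s y n) atTop (𝓝 0) := by
      have hb : Tendsto (fun n : ℕ => C * (‖x‖ + ‖y‖) ^ 2 / (2 : ℝ) ^ n) atTop (𝓝 0) :=
        tendsto_const_nhds.div_atTop (tendsto_pow_atTop_atTop_of_one_lt (by norm_num))
      refine squeeze_zero_norm' ?_ hb
      filter_upwards [hsmall x, hsmall y] with n hx hy
      have h1 := hadd _ _ hx hy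
      have h3 : s (x + y) n - s x n - s y n = (2 : ℝ) ^ n •
          (f (((2 : ℝ) ^ n)⁻¹ • x + ((2 : ℝ) ^ n)⁻¹ • y) - f (((2 : ℝ) ^ n)⁻¹ • x)
            - f (((2 : ℝ) ^ n)⁻¹ • y)) := by
        simp only [s, smul_sub, smul_add]
      rw [h3, norm_smul, norm_pow, Real.norm_ofNat]
      rw [hnorm, hnorm] at h1
      calc _ ≤ (2 : ℝ) ^ n * (C * (‖x‖ / 2 ^ n + ‖y‖ / 2 ^ n) ^ 2) := by gcongr
        _ = _ := by field_simp
    have h4 := tendsto_nhds_unique hlim0 (((hl (x + y)).sub (hl x)).sub (hl y))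
    rw [sub_sub] at h4
    exact (sub_eq_zero.1 h4.symm)
  have hlK : ∀ x, ‖l x‖ ≤ K * ‖x‖ := by
    intro x
    refine le_of_tendsto (hl x).norm ?_
    filter_upwards [hsmall x] with n hn
    have h1 := hf _ hn
    simp only [s]
    rw [norm_smul, norm_pow, Real.norm_ofNat]
    rw [hnorm] at h1
    calc _ ≤ (2 : ℝ) ^ n * (K * (‖x‖ / 2 ^ n)) := by gcongr
      _ = _ := by field_simp
  have hlf : ∀ x, ‖x‖ < r → ‖f x - l x‖ ≤ 2 * C * ‖x‖ ^ 2 := by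
    intro x hx
    have := dist_le_of_le_geometric_two_of_tendsto₀ (hstep x hx) (hl x)
    simpa [s, dist_eq_norm] using this
  let l' : X →+ Y := AddMonoidHom.mk' l hladd
  have hc : Continuous l' := AddMonoidHomClass.continuous_of_bound l' K hlK
  refine ⟨l'.toRealLinearMap hc, ?_⟩
  have hf0 : f 0 = 0 := by
    have := hf 0 (by simpa using hr)
    simpa using this
  rw [hasFDerivAt_iff_isLittleO_nhds_zero]
  have hO : (fun h => f (0 + h) - f 0 - (l'.toRealLinearMap hc) h) =O[𝓝 0] fun h : X => ‖h‖ ^ 2 := by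
    refine Asymptotics.IsBigO.of_bound (2 * C) ?_
    filter_upwards [Metric.ball_mem_nhds (0 : X) hr] with h hh
    rw [zero_add, hf0, sub_zero, norm_pow, norm_norm]
    exact hlf h (by simpa using hh)
  refine hO.trans_isLittleO ?_
  have := Asymptotics.isLittleO_pow_id (𝕜 := ℝ) (n := 2) (by norm_num)
  exact (this.comp_tendsto (tendsto_norm_zero (E := X))).trans_isBigO
    (Asymptotics.isBigO_refl _ _).norm_left

/-- Put `w = 1 - u`, so `w (D x) ≤ (w x) ^ 2`. The weight `1 + c ‖x‖` has the opposite behaviour, `1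
+ c ‖D x‖ ≤ (1 + c ‖x‖) ^ 2`. Hence a bound `1 ≤ w (1 + c ‖x‖) ^ K` at `D x` passes to `x` by a
square root; it starts on a shell away from `0`, where `K` can be chosen large. -/
theorem exists_bound_of_doubling {X : Type*} [NormedAddCommGroup X] [NormedSpace ℝ X] {u : X → ℝ}
    {D : X → X} {c : ℝ} (hc : 0 < c) (hD : ∀ᶠ x in 𝓝 (0 : X), ‖D x - (2 : ℝ) • x‖ ≤ c * ‖x‖ ^ 2)
    (hu : ∀ᶠ x in 𝓝 (0 : X), u x ≤ 1 / 2)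
    (huD : ∀ᶠ x in 𝓝 (0 : X), 1 - u (D x) ≤ (1 - u x) ^ 2) (hu0 : u 0 ≤ 0) :
    ∃ K : ℝ, ∀ᶠ x in 𝓝 (0 : X), u x ≤ K * ‖x‖ := by
  obtain ⟨r₁, hr₁, h₁⟩ := Metric.eventually_nhds_iff.1 (hD.and (hu.and huD))
  obtain ⟨r, hr, hcr, hrr⟩ : ∃ r > 0, c * r ≤ 1 / 2 ∧ r ≤ r₁ := by
    refine ⟨min r₁ (1 / (2 * c)), lt_min hr₁ (by positivity), ?_, min_le_left _ _⟩
    calc c * min r₁ (1 / (2 * c)) ≤ c * (1 / (2 * c)) := by gcongr; exact min_le_right _ _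
      _ = 1 / 2 := by field_simp
  have hr' : ∀ x : X, ‖x‖ < r → ‖D x - (2 : ℝ) • x‖ ≤ c * ‖x‖ ^ 2 ∧ u x ≤ 1 / 2 ∧
      1 - u (D x) ≤ (1 - u x) ^ 2 := fun x hx => h₁ (by simpa using hx.trans_le hrr)
  obtain ⟨K, hK⟩ : ∃ K : ℕ, 2 < (1 + c * (r / 3)) ^ K :=
    pow_unbounded_of_one_lt 2 (by have : 0 < c * (r / 3) := by positivity
                                  linarith)
  -- The number `n` bounds the doublings needed to reach the shell `r / 3 ≤ ‖x‖ < r`. The choice `c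
  -- * r ≤ 1 / 2` makes `D` scale norms by a factor between `3 / 2` and `5 / 2`, so the orbit
  -- reaches the shell without leaving the ball.
  have key : ∀ n : ℕ, ∀ x : X, ‖x‖ < r → r ≤ 3 * ((3 / 2 : ℝ) ^ n * ‖x‖) →
      1 ≤ (1 - u x) * (1 + c * ‖x‖) ^ K := by
    have base : ∀ x : X, ‖x‖ < r → r ≤ 3 * ‖x‖ → 1 ≤ (1 - u x) * (1 + c * ‖x‖) ^ K := by
      intro x hx hx'
      have h1 : 2 ≤ (1 + c * ‖x‖) ^ K := by
        refine hK.le.trans ?_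
        gcongr
        linarith
      have h2 := (hr' x hx).2.1
      nlinarith
    intro n
    induction n with
    | zero => intro x hx hx'; exact base x hx (by simpa using hx')
    | succ n ih =>
      intro x hx hx'
      by_cases h3 : r ≤ 3 * ‖x‖
      · exact base x hx h3
      push Not at h3
      obtain ⟨hd, hux, huD⟩ := hr' x hx
      have hn := norm_nonneg x
      have hcx : c * ‖x‖ ^ 2 ≤ ‖x‖ / 2 := by nlinarith
      have hle : ‖D x‖ ≤ 2 * ‖x‖ + c * ‖x‖ ^ 2 := by
        have := norm_add_le (D x - (2 : ℝ) • x) ((2 : ℝ) • x)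
        rw [sub_add_cancel, norm_smul, Real.norm_ofNat] at this
        linarith
      have hge : 3 / 2 * ‖x‖ ≤ ‖D x‖ := by
        have := norm_sub_norm_le ((2 : ℝ) • x) (D x)
        rw [norm_sub_rev, norm_smul, Real.norm_ofNat] at this
        linarith
      have hDr : ‖D x‖ < r := by linarith
      have h4 := ih (D x) hDr (by
        refine hx'.trans ?_
        rw [pow_succ, mul_assoc]
        gcongr)
      have h5 : (1 + c * ‖D x‖) ^ K ≤ ((1 + c * ‖x‖) ^ 2) ^ K := by
        gcongr
        nlinarith
      have h6 : 1 ≤ (1 - u x) ^ 2 * ((1 + c * ‖x‖) ^ 2) ^ K := by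
        refine h4.trans ?_
        refine (mul_le_mul_of_nonneg_right huD (by positivity)).trans ?_
        gcongr
      have h7 : 1 ≤ ((1 - u x) * (1 + c * ‖x‖) ^ K) ^ 2 := by
        rw [mul_pow, ← pow_mul, mul_comm K 2, pow_mul]
        exact h6
      have h8 : 0 ≤ (1 - u x) * (1 + c * ‖x‖) ^ K :=
        mul_nonneg (by linarith) (by positivity)
      nlinarith
  refine ⟨K * c, ?_⟩
  filter_upwards [Metric.ball_mem_nhds (0 : X) hr] with x hx
  have hx : ‖x‖ < r := by simpa using hx
  rcases eq_or_ne x 0 with rfl | hx0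
  · simpa using hu0
  have hxpos : 0 < ‖x‖ := norm_pos_iff.2 hx0
  obtain ⟨n, hn⟩ := pow_unbounded_of_one_lt (r / (3 * ‖x‖)) (show (1 : ℝ) < 3 / 2 by norm_num)
  have h1 := key n x hx (by
    rw [div_lt_iff₀ (by positivity)] at hn
    linarith)
  set t := c * ‖x‖ with ht
  have ht0 : 0 < t := by positivity
  -- Bernoulli's inequality for `1 / (1 + t) = 1 - t / (1 + t)`, which turns the lower bound `(1 +
  -- t)⁻ᴷ` for `1 - u x` into one linear in `t`.
  have h2 := one_add_mul_le_pow (a := -(t / (1 + t))) (by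
    have : t / (1 + t) ≤ 1 := by rw [div_le_one (by positivity)]; linarith
    linarith) K
  have h3 : (1 + -(t / (1 + t))) ^ K * (1 + t) ^ K = 1 := by
    rw [← mul_pow]
    have : (1 + -(t / (1 + t))) * (1 + t) = 1 := by field_simp; ring
    rw [this, one_pow]
  have h4 : (1 + -(t / (1 + t))) ^ K ≤ 1 - u x := by
    have h5 : 0 < (1 + t) ^ K := by positivity
    by_contra hcon
    push Not at hcon
    nlinarith
  have h5 : t / (1 + t) ≤ t := div_le_self ht0.le (by linarith)
  have h6 : (K : ℝ) * (t / (1 + t)) ≤ K * t := by gcongr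
  rw [mul_assoc, ← ht]
  linarith

/-- The derivative of a `C²` map is Lipschitz near `a`, so the mean value inequality along the
segment from `a` to `x` gives a quadratic Taylor remainder. -/
theorem ContDiffAt.exists_norm_sub_sub_fderiv_le {X Y : Type*} [NormedAddCommGroup X]
    [NormedSpace ℝ X] [NormedAddCommGroup Y] [NormedSpace ℝ Y] {h : X → Y} {a : X}
    (hh : ContDiffAt ℝ 2 h a) :
    ∃ c > 0, ∀ᶠ x in 𝓝 a, ‖h x - h a - fderiv ℝ h a (x - a)‖ ≤ c * ‖x - a‖ ^ 2 := by
  have h1 : ContDiffAt ℝ 1 (fderiv ℝ h) a := hh.fderiv_right (by norm_num)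
  obtain ⟨K, t, ht, hK⟩ := h1.exists_lipschitzOnWith
  have hd : ∀ᶠ x in 𝓝 a, DifferentiableAt ℝ h x :=
    (hh.eventually (by simp)).mono fun x hx => hx.differentiableAt (by simp)
  obtain ⟨r, hr, hb⟩ := Metric.mem_nhds_iff.1 (inter_mem ht hd)
  refine ⟨K + 1, by positivity, ?_⟩
  filter_upwards [Metric.ball_mem_nhds a hr] with x hx
  have hsub : segment ℝ a x ⊆ Metric.ball a r :=
    (convex_ball a r).segment_subset (Metric.mem_ball_self hr) hx
  have := (convex_segment a x).norm_image_sub_le_of_norm_hasFDerivWithin_le'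
    (f := h) (f' := fderiv ℝ h) (φ := fderiv ℝ h a) (C := K * ‖x - a‖)
    (fun y hy => ((hb (hsub hy)).2 : DifferentiableAt ℝ h y).hasFDerivAt.hasFDerivWithinAt)
    (fun y hy => by
      have h2 := hK.dist_le_mul y (hb (hsub hy)).1 a (mem_of_mem_nhds ht)
      rw [dist_eq_norm, dist_eq_norm] at h2
      refine h2.trans ?_
      gcongr
      exact norm_sub_le_of_mem_segment hy)
    (left_mem_segment ℝ a x) (right_mem_segment ℝ a x)
  refine this.trans ?_
  nlinarith [sq_nonneg ‖x - a‖]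

end Analytic

/-! ### The left logarithmic derivative -/

section LeftLogDeriv

variable {V E G : Type*} [NormedAddCommGroup V] [NormedSpace ℝ V]
  [NormedAddCommGroup E] [NormedSpace ℝ E] [TopologicalSpace G] [ChartedSpace E G] [Group G]

/-- The left logarithmic derivative `σ(c)⁻¹ σ'(c)` of a curve or of a family `σ` in a Lie group. -/
def leftLogDeriv (σ : V → G) (c : V) : V →L[ℝ] E :=
  fderiv ℝ (fun y => extChartAt 𝓘(ℝ, E) (1 : G) ((σ c)⁻¹ * σ y)) c

variable [LieGroup 𝓘(ℝ, E) ∞ G]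

/-- Treating `(σ c)⁻¹ * σ y` as a function of both variables near the diagonal is what later gives
smooth dependence on `c` of the derivative in `y`. -/
theorem leftLogDeriv_aux {σ : V → G} {U : Set V} (hU : IsOpen U)
    (hσ : ContMDiffOn 𝓘(ℝ, V) 𝓘(ℝ, E) ∞ σ U) :
    ∃ O : Set (V × V), IsOpen O ∧ (∀ c ∈ U, (c, c) ∈ O) ∧
      (∀ p ∈ O, (σ p.1)⁻¹ * σ p.2 ∈ (extChartAt 𝓘(ℝ, E) (1 : G)).source) ∧
      ContDiffOn ℝ ∞ (fun p : V × V => extChartAt 𝓘(ℝ, E) (1 : G) ((σ p.1)⁻¹ * σ p.2)) O := by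
  have h1 : ContMDiffOn 𝓘(ℝ, V × V) 𝓘(ℝ, E) ∞ (fun p : V × V => (σ p.1)⁻¹ * σ p.2) (U ×ˢ U) := by
    refine ContMDiffOn.mul (ContMDiffOn.inv (hσ.comp (t := U) ?_ (fun p hp => hp.1)))
      (hσ.comp (t := U) ?_ (fun p hp => hp.2))
    · exact contDiff_fst.contMDiff.contMDiffOn
    · exact contDiff_snd.contMDiff.contMDiffOn
  refine ⟨(U ×ˢ U) ∩ (fun p : V × V => (σ p.1)⁻¹ * σ p.2) ⁻¹' (extChartAt 𝓘(ℝ, E) (1 : G)).source,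
    h1.continuousOn.isOpen_inter_preimage (hU.prod hU) (isOpen_extChartAt_source 1), ?_,
    fun p hp => hp.2, ?_⟩
  · intro c hc
    refine ⟨⟨hc, hc⟩, ?_⟩
    simp only [mem_preimage, inv_mul_cancel]
    exact mem_extChartAt_source 1
  · rw [← contMDiffOn_iff_contDiffOn]
    refine (contMDiffOn_extChartAt (x := (1 : G))).comp (h1.mono inter_subset_left) ?_
    intro p hp
    have := hp.2
    rwa [mem_preimage, extChartAt_source] at this

/-- The logarithmic derivative is a partial derivative of a jointly smooth function, restricted to
the diagonal. -/
theorem contDiffOn_leftLogDeriv {σ : V → G} {U : Set V} (hU : IsOpen U)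
    (hσ : ContMDiffOn 𝓘(ℝ, V) 𝓘(ℝ, E) ∞ σ U) :
    ContDiffOn ℝ ∞ (leftLogDeriv (E := E) σ) U := by
  obtain ⟨O, hO, hdiag, -, hQ⟩ := leftLogDeriv_aux hU hσ
  have h1 : ContDiffOn ℝ ∞ (fun c : V => (fderiv ℝ (fun p : V × V =>
      extChartAt 𝓘(ℝ, E) (1 : G) ((σ p.1)⁻¹ * σ p.2)) (c, c)).comp (.inr ℝ V V)) U := by
    refine ContDiffOn.clm_comp ?_ contDiffOn_const
    exact (hQ.fderiv_of_isOpen hO (by simp)).comp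
      (contDiff_id.prodMk contDiff_id).contDiffOn (fun c hc => hdiag c hc)
  refine h1.congr fun c hc => ?_
  have hd := (hQ.contDiffAt (hO.mem_nhds (hdiag c hc))).differentiableAt (by simp)
  have hi : HasFDerivAt (fun y : V => (c, y)) (ContinuousLinearMap.inr ℝ V V) c :=
    hasFDerivAt_prodMk_right c c
  exact (HasFDerivAt.comp c hd.hasFDerivAt hi).fderiv

/-- The map takes the value `1` at `y = c`, and the preferred chart at `1` is the one identifying
the tangent space there with `E`; no change of coordinates intervenes. -/
theorem hasMFDerivAt_leftLogDeriv {σ : V → G} {U : Set V} (hU : IsOpen U)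
    (hσ : ContMDiffOn 𝓘(ℝ, V) 𝓘(ℝ, E) ∞ σ U) {c : V} (hc : c ∈ U) :
    HasMFDerivAt 𝓘(ℝ, V) 𝓘(ℝ, E) (fun y => (σ c)⁻¹ * σ y) c
      (leftLogDeriv (E := E) σ c : V →L[ℝ] E) := by
  have h1 : MDifferentiableAt 𝓘(ℝ, V) 𝓘(ℝ, E) (fun y => (σ c)⁻¹ * σ y) c :=
    (contMDiff_mul_left.contMDiffAt.comp c
      (hσ.contMDiffAt (hU.mem_nhds hc))).mdifferentiableAt (by simp)
  convert h1.hasMFDerivAt using 1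
  rw [h1.mfderiv]
  simp only [leftLogDeriv, writtenInExtChartAt, mfld_simps, fderivWithin_univ, inv_mul_cancel]
  rfl

end LeftLogDeriv

/-! ### Norm-continuous representations are smooth -/

section Representation

variable {E G A : Type*} [NormedAddCommGroup E] [NormedSpace ℝ E] [TopologicalSpace G]
  [ChartedSpace E G] [Group G] [LieGroup 𝓘(ℝ, E) ∞ G] [NormedRing A] [NormedAlgebra ℝ A]
  [CompleteSpace A]

open Filter

/-- A norm-continuous homomorphism into a Banach algebra is differentiable at `1`. -/
theorem MonoidHom.exists_hasFDerivAt_chart_of_continuous (ρ : G →* A) (hρ : Continuous ρ) :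
    ∃ L : E →L[ℝ] A, HasFDerivAt (fun x => ρ ((extChartAt 𝓘(ℝ, E) (1 : G)).symm x)) L
      (extChartAt 𝓘(ℝ, E) (1 : G) 1) := by
  set χ := extChartAt 𝓘(ℝ, E) (1 : G) with hχ
  set a := χ 1 with ha
  let p : E → G := fun x => χ.symm (a + x)
  have h1χ : (1 : G) ∈ χ.source := mem_extChartAt_source 1
  have hp0 : p 0 = 1 := by simp only [p, add_zero]; exact χ.left_inv h1χ
  have hpt : ∀ᶠ x in 𝓝 (0 : E), a + x ∈ χ.target := by
    have h : ContinuousAt (fun x : E => a + x) 0 := by fun_prop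
    exact h.eventually (by simp only [add_zero]; exact extChartAt_target_mem_nhds (I := 𝓘(ℝ, E)) (1 : G))
  have hp : ContMDiffAt 𝓘(ℝ, E) 𝓘(ℝ, E) ∞ p 0 := by
    have h1 : ContMDiffAt 𝓘(ℝ, E) 𝓘(ℝ, E) ∞ χ.symm (a + 0) := by
      refine (contMDiffOn_extChartAt_symm (I := 𝓘(ℝ, E)) (1 : G)).contMDiffAt ?_
      rw [add_zero]
      exact extChartAt_target_mem_nhds (I := 𝓘(ℝ, E)) (1 : G)
    have h2 : ContMDiffAt 𝓘(ℝ, E) 𝓘(ℝ, E) ∞ (fun x : E => a + x) 0 :=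
      (contDiff_const.add contDiff_id).contMDiff.contMDiffAt
    exact h1.comp (0 : E) h2
  have hp1 : ContMDiffAt 𝓘(ℝ, E × E) 𝓘(ℝ, E) ∞ (fun q : E × E => p q.1) (0, 0) :=
    ContMDiffAt.comp (g := p) (f := Prod.fst) (0, 0) hp contDiff_fst.contMDiff.contMDiffAt
  have hp2 : ContMDiffAt 𝓘(ℝ, E × E) 𝓘(ℝ, E) ∞ (fun q : E × E => p q.2) (0, 0) :=
    ContMDiffAt.comp (g := p) (f := Prod.snd) (0, 0) hp contDiff_snd.contMDiff.contMDiffAt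
  -- a smooth group-valued map which is `1` at the origin, in coordinates
  have hcoord : ∀ m : E × E → G, ContMDiffAt 𝓘(ℝ, E × E) 𝓘(ℝ, E) ∞ m (0, 0) → m (0, 0) = 1 →
      ContDiffAt ℝ ∞ (fun q => χ (m q) - a) (0, 0) ∧ ∀ᶠ q in 𝓝 ((0, 0) : E × E),
        p (χ (m q) - a) = m q := by
    intro m hm hm1
    have h1 : ContMDiffAt 𝓘(ℝ, E) 𝓘(ℝ, E) ∞ χ (m (0, 0)) := by
      rw [hm1]
      exact contMDiffAt_extChartAt
    constructor
    · exact (h1.comp _ hm).contDiffAt.sub contDiffAt_const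
    · have : ∀ᶠ q in 𝓝 ((0, 0) : E × E), m q ∈ χ.source :=
        hm.continuousAt.eventually (by rw [hm1]; exact extChartAt_source_mem_nhds 1)
      filter_upwards [this] with q hq
      simp only [p, add_sub_cancel]
      exact χ.left_inv hq
  let M : E × E → E := fun q => χ (p q.1 * p q.2) - a
  let Q : E × E → E := fun q => χ ((p q.1)⁻¹ * p q.2) - a
  obtain ⟨hM, hpM⟩ := hcoord (fun q => p q.1 * p q.2) (hp1.mul hp2) (by simp [hp0])
  obtain ⟨hQ, hpQ⟩ := hcoord (fun q => (p q.1)⁻¹ * p q.2) (hp1.inv.mul hp2) (by simp [hp0])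
  have hM00 : M (0, 0) = 0 := by simp [M, hp0, ← ha]
  have hpχ : ∀ᶠ x in 𝓝 (0 : E), χ (p x) = a + x := by
    filter_upwards [hpt] with x hx using χ.right_inv hx
  -- In the coordinate `p`, `M (x, 0) = x` and `M (0, x) = x` near `0`, so to first order
  -- multiplication is addition.
  have hdM : fderiv ℝ M (0, 0) = .fst ℝ E E + .snd ℝ E E := by
    have hd : HasFDerivAt M (fderiv ℝ M (0, 0)) (0, 0) :=
      (hM.differentiableAt (by simp)).hasFDerivAt
    refine ContinuousLinearMap.prod_ext ?_ ?_
    · have A1 : HasFDerivAt (fun x => M (x, 0)) _ (0 : E) :=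
        HasFDerivAt.comp (g := M) (0 : E) hd (ContinuousLinearMap.inl ℝ E E).hasFDerivAt
      have A2 : HasFDerivAt (fun x => M (x, 0)) (.id ℝ E) (0 : E) := by
        refine (hasFDerivAt_id (0 : E)).congr_of_eventuallyEq ?_
        filter_upwards [hpχ] with x hx
        simp [M, hp0, hx]
      refine (A1.unique A2).trans ?_
      ext
      simp
    · have A1 : HasFDerivAt (fun x => M (0, x)) _ (0 : E) :=
        HasFDerivAt.comp (g := M) (0 : E) hd (ContinuousLinearMap.inr ℝ E E).hasFDerivAt
      have A2 : HasFDerivAt (fun x => M (0, x)) (.id ℝ E) (0 : E) := by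
        refine (hasFDerivAt_id (0 : E)).congr_of_eventuallyEq ?_
        filter_upwards [hpχ] with x hx
        simp [M, hp0, hx]
      refine (A1.unique A2).trans ?_
      ext
      simp
  -- quadratic estimate for the multiplication
  obtain ⟨c, hc, hMc⟩ : ∃ c > 0, ∀ᶠ q in 𝓝 ((0, 0) : E × E),
      ‖M q - (q.1 + q.2)‖ ≤ c * (‖q.1‖ + ‖q.2‖) ^ 2 := by
    obtain ⟨c, hc, h⟩ := (hM.of_le (m := 2) ENat.LEInfty.out).exists_norm_sub_sub_fderiv_le
    refine ⟨c, hc, ?_⟩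
    filter_upwards [h] with q hq
    change ‖M q - M (0, 0) - fderiv ℝ M (0, 0) (q - 0)‖ ≤ c * ‖q - 0‖ ^ 2 at hq
    rw [hdM, hM00, sub_zero, sub_zero] at hq
    refine (show ‖M q - (q.1 + q.2)‖ ≤ c * ‖q‖ ^ 2 from hq).trans ?_
    have : ‖q‖ ≤ ‖q.1‖ + ‖q.2‖ := by
      rw [Prod.norm_def]
      exact max_le (by simp) (by simp)
    gcongr
  -- Lipschitz estimate for the division
  obtain ⟨k, hk, hQk⟩ : ∃ k : ℝ, 0 ≤ k ∧ ∀ᶠ q in 𝓝 ((0, 0) : E × E),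
      ‖Q q‖ ≤ k * ‖q.2 - q.1‖ := by
    obtain ⟨K, t, ht, hK⟩ := (hQ.of_le (m := 1) (by exact_mod_cast le_top)).exists_lipschitzOnWith
    refine ⟨K, K.2, ?_⟩
    have hdiag : Tendsto (fun q : E × E => (q.1, q.1)) (𝓝 (0, 0)) (𝓝 (0, 0)) := by
      have : Continuous (fun q : E × E => (q.1, q.1)) := by fun_prop
      exact this.tendsto' _ _ rfl
    filter_upwards [ht, hdiag ht] with q hq hq'
    have h1 : dist (Q q) (Q (q.1, q.1)) ≤ K * dist q (q.1, q.1) := hK.dist_le_mul q hq _ hq'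
    -- Division is trivial on the diagonal, so the Lipschitz bound is measured from `(q.1, q.1)`.
    have h0 : Q (q.1, q.1) = 0 := by simp [Q, ← ha]
    rw [h0, dist_zero_right, Prod.dist_eq, dist_self, dist_eq_norm] at h1
    simpa using h1
  let f : E → A := fun x => ρ (p x) - 1
  have hρp : ContinuousAt (fun x => ρ (p x)) 0 := hρ.continuousAt.comp hp.continuousAt
  have hf0 : f 0 = 0 := by simp [f, hp0]
  have hfc : ContinuousAt f 0 := hρp.sub continuousAt_const
  have hfM : ∀ᶠ q in 𝓝 ((0, 0) : E × E), f (M q) = f q.1 + f q.2 + f q.1 * f q.2 := by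
    filter_upwards [hpM] with q hq
    change p (M q) = p q.1 * p q.2 at hq
    simp only [f, hq, map_mul]
    noncomm_ring
  have hdg : Tendsto (fun x : E => (x, x)) (𝓝 0) (𝓝 (0, 0)) := by
    have : Continuous (fun x : E => (x, x)) := by fun_prop
    exact this.tendsto' _ _ rfl
  obtain ⟨K, hK⟩ : ∃ K : ℝ, ∀ᶠ x in 𝓝 (0 : E), ‖f x‖ ≤ K * ‖x‖ := by
    refine exists_bound_of_doubling (u := fun x => ‖f x‖) (D := fun x => M (x, x)) (c := c * 4)
      (by positivity) ?_ ?_ ?_ (by simp [hf0])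
    · filter_upwards [hdg.eventually hMc] with x hx
      rw [two_smul]
      refine hx.trans (le_of_eq ?_)
      ring
    · have : Tendsto (fun x => ‖f x‖) (𝓝 0) (𝓝 0) := by simpa [hf0] using hfc.norm.tendsto
      exact this.eventually (ge_mem_nhds (by norm_num))
    · filter_upwards [hdg.eventually hfM] with x hx
      -- Multiplicativity on a square, `2 f = f ∘ D - f²` with `D x = M (x, x)`, yields `1 - ‖f (D
      -- x)‖ ≤ (1 - ‖f x‖) ^ 2` after taking norms.
      have h2 : f x + f x = f (M (x, x)) - f x * f x := by rw [hx]; simp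
      have h3 : ‖f x + f x‖ = 2 * ‖f x‖ := by
        rw [← two_smul ℝ (f x), norm_smul, Real.norm_ofNat]
      have h4 : ‖f x + f x‖ ≤ ‖f (M (x, x))‖ + ‖f x‖ * ‖f x‖ := by
        rw [h2]
        exact (norm_sub_le _ _).trans (by gcongr; exact norm_mul_le _ _)
      nlinarith
  have hMt : Tendsto M (𝓝 (0, 0)) (𝓝 0) := by
    have := hM.continuousAt.tendsto
    change Tendsto M (𝓝 (0, 0)) (𝓝 (M (0, 0))) at this
    rwa [hM00] at this
  have hAt : Tendsto (fun q : E × E => q.1 + q.2) (𝓝 (0, 0)) (𝓝 0) := by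
    have : Continuous (fun q : E × E => q.1 + q.2) := by fun_prop
    exact this.tendsto' _ _ (by simp)
  obtain ⟨b, hb⟩ : ∃ b : ℝ, ∀ᶠ x in 𝓝 (0 : E), ‖ρ (p x)‖ ≤ b :=
    ⟨‖ρ (p 0)‖ + 1, hρp.norm.eventually (ge_mem_nhds (by linarith))⟩
  -- Compare `f (q.1 + q.2)` with `f (M q)`. The group elements differ by the factor with coordinate
  -- `Q (M q, q.1 + q.2)`, which is `O(‖M q - (q.1 + q.2)‖)`, hence quadratic, and `f` is linearly
  -- bounded on it. The remaining product `f q.1 * f q.2` is quadratic too.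
  have hadd : ∀ᶠ q in 𝓝 ((0, 0) : E × E), ‖f (q.1 + q.2) - f q.1 - f q.2‖ ≤
      (|b| * (|K| * (k * c)) + K ^ 2) * (‖q.1‖ + ‖q.2‖) ^ 2 := by
    have hz : Tendsto (fun q : E × E => (M q, q.1 + q.2)) (𝓝 (0, 0)) (𝓝 (0, 0)) :=
      hMt.prodMk_nhds hAt
    have hQt : Tendsto Q (𝓝 (0, 0)) (𝓝 0) := by
      have := hQ.continuousAt.tendsto
      change Tendsto Q (𝓝 (0, 0)) (𝓝 (Q (0, 0))) at this
      rwa [show Q (0, 0) = 0 by simp [Q, ← ha]] at this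
    have hfst : Tendsto (fun q : E × E => q.1) (𝓝 (0, 0)) (𝓝 0) :=
      continuous_fst.tendsto' _ _ rfl
    have hsnd : Tendsto (fun q : E × E => q.2) (𝓝 (0, 0)) (𝓝 0) :=
      continuous_snd.tendsto' _ _ rfl
    filter_upwards [hMc, hfM, hz.eventually hQk, hz.eventually hpQ, hMt.eventually hb,
      (hQt.comp hz).eventually hK, hfst.eventually hK, hsnd.eventually hK]
      with q h1 h2 h3 h4 h5 h6 h7 h8
    simp only [Function.comp_def] at h6
    change p (Q (M q, q.1 + q.2)) = (p (M q))⁻¹ * p (q.1 + q.2) at h4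
    have e1 : f (q.1 + q.2) - f (M q) = ρ (p (M q)) * f (Q (M q, q.1 + q.2)) := by
      simp only [f, h4, mul_sub, ← map_mul, mul_inv_cancel_left, mul_one, sub_sub_sub_cancel_right]
    have e2 : f (q.1 + q.2) - f q.1 - f q.2 =
        ρ (p (M q)) * f (Q (M q, q.1 + q.2)) + f q.1 * f q.2 := by
      rw [← e1, h2]
      abel
    have n1 : ‖ρ (p (M q))‖ ≤ |b| := h5.trans (le_abs_self b)
    have n2 : ‖q.1 + q.2 - M q‖ ≤ c * (‖q.1‖ + ‖q.2‖) ^ 2 := by rwa [norm_sub_rev]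
    have n3 : ‖f (Q (M q, q.1 + q.2))‖ ≤ |K| * (k * (c * (‖q.1‖ + ‖q.2‖) ^ 2)) := by
      refine h6.trans ?_
      refine mul_le_mul (le_abs_self K) (h3.trans ?_) (norm_nonneg _) (abs_nonneg _)
      gcongr
    have n4 : ‖f q.1 * f q.2‖ ≤ K ^ 2 * (‖q.1‖ + ‖q.2‖) ^ 2 := by
      refine (norm_mul_le _ _).trans ((mul_le_mul h7 h8 (norm_nonneg _)
        ((norm_nonneg _).trans h7)).trans ?_)
      have : K * ‖q.1‖ * (K * ‖q.2‖) = K ^ 2 * (‖q.1‖ * ‖q.2‖) := by ring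
      rw [this]
      gcongr
      nlinarith [norm_nonneg q.1, norm_nonneg q.2]
    rw [e2]
    calc _ ≤ ‖ρ (p (M q))‖ * ‖f (Q (M q, q.1 + q.2))‖ + ‖f q.1 * f q.2‖ :=
          (norm_add_le _ _).trans (by gcongr; exact norm_mul_le _ _)
      _ ≤ |b| * (|K| * (k * (c * (‖q.1‖ + ‖q.2‖) ^ 2))) + K ^ 2 * (‖q.1‖ + ‖q.2‖) ^ 2 := by gcongr
      _ = _ := by ring
  obtain ⟨L, hL⟩ := exists_hasFDerivAt_zero_of_approx_additive hK hadd
  refine ⟨L, ?_⟩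
  have h1 : HasFDerivAt (fun x => f (x - a) + 1) L a := by
    refine HasFDerivAt.add_const (1 : A) ?_
    have h2 : HasFDerivAt (fun x : E => x - a) (.id ℝ E) a := (hasFDerivAt_id a).sub_const a
    have h3 : HasFDerivAt f L (a - a) := by rwa [sub_self]
    exact HasFDerivAt.comp (g := f) (f := fun x => x - a) a h3 h2
  convert h1 using 2 with x
  simp [f, p]

/-- A norm-continuous homomorphism into a Banach algebra is smooth. -/
theorem MonoidHom.contMDiff_of_continuous (ρ : G →* A) (hρ : Continuous ρ) :
    ContMDiff 𝓘(ℝ, E) 𝓘(ℝ, A) ∞ ρ := by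
  obtain ⟨L, hL⟩ := ρ.exists_hasFDerivAt_chart_of_continuous (E := E) hρ
  set χ := extChartAt 𝓘(ℝ, E) (1 : G) with hχ
  have hU : IsOpen χ.target := isOpen_extChartAt_target (I := 𝓘(ℝ, E)) (1 : G)
  have hσ : ContMDiffOn 𝓘(ℝ, E) 𝓘(ℝ, E) ∞ χ.symm χ.target :=
    contMDiffOn_extChartAt_symm (I := 𝓘(ℝ, E)) (1 : G)
  let ψ : E → A := fun x => ρ (χ.symm x)
  -- Differentiate `ρ(y) = ρ(x) ρ(x⁻¹ y)` at `y = x`: this yields `ψ' = ψ · (L ∘ ω)`, with `ω` the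
  -- left logarithmic derivative of the inverse chart.
  have hψ : ∀ x ∈ χ.target, HasFDerivAt ψ
      ((ContinuousLinearMap.mul ℝ A (ψ x)).comp (L.comp (leftLogDeriv (E := E) χ.symm x))) x := by
    intro x hx
    obtain ⟨O, hO, hdiag, hOs, hQ⟩ := leftLogDeriv_aux hU hσ
    have hQx : HasFDerivAt (fun y => χ ((χ.symm x)⁻¹ * χ.symm y))
        (leftLogDeriv (E := E) χ.symm x) x := by
      have hd := (hQ.contDiffAt (hO.mem_nhds (hdiag x hx))).differentiableAt (by simp)
      exact (DifferentiableAt.comp (g := fun p : E × E => χ ((χ.symm p.1)⁻¹ * χ.symm p.2)) x hd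
        (hasFDerivAt_prodMk_right x x).differentiableAt).hasFDerivAt
    have hL' : HasFDerivAt ψ L (χ ((χ.symm x)⁻¹ * χ.symm x)) := by rwa [inv_mul_cancel]
    refine ((ContinuousLinearMap.mul ℝ A (ψ x)).hasFDerivAt.comp x
      (hL'.comp x hQx)).congr_of_eventuallyEq ?_
    have hOx : ∀ᶠ y in 𝓝 x, (x, y) ∈ O :=
      (continuous_const.prodMk continuous_id).continuousAt.eventually
        (hO.mem_nhds (hdiag x hx))
    filter_upwards [hOx] with y hy
    have h1 : χ.symm (χ ((χ.symm x)⁻¹ * χ.symm y)) = (χ.symm x)⁻¹ * χ.symm y :=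
      χ.left_inv (hOs _ hy)
    simp only [ψ, Function.comp_apply, ContinuousLinearMap.mul_apply', h1, ← map_mul,
      mul_inv_cancel_left]
  have hω : ContDiffOn ℝ ∞ (leftLogDeriv (E := E) χ.symm) χ.target := contDiffOn_leftLogDeriv hU hσ
  -- Bootstrap: `ω` is smooth, so the equation makes `ψ'` as regular as `ψ`.
  have hn : ∀ n : ℕ, ContDiffOn ℝ n ψ χ.target := by
    intro n
    induction n with
    | zero =>
      exact contDiffOn_zero.2 fun x hx => (hψ x hx).continuousAt.continuousWithinAt
    | succ n ih =>
      have : ((n + 1 : ℕ) : ℕ∞ω) = (n : ℕ∞ω) + 1 := by push_cast; rfl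
      rw [this, contDiffOn_succ_iff_fderiv_of_isOpen hU]
      refine ⟨fun x hx => (hψ x hx).differentiableAt.differentiableWithinAt, by simp, ?_⟩
      refine ContDiffOn.congr ?_ (fun x hx => (hψ x hx).fderiv)
      refine ContDiffOn.clm_comp ?_ (contDiffOn_const.clm_comp (hω.of_le ?_))
      · exact (ContinuousLinearMap.mul ℝ A).contDiff.comp_contDiffOn ih
      · exact_mod_cast le_top
  have hψs : ContDiffOn ℝ ∞ ψ χ.target := contDiffOn_infty.2 hn
  have h1 : ContMDiffAt 𝓘(ℝ, E) 𝓘(ℝ, A) ∞ ρ 1 := by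
    have h2 : ContMDiffAt 𝓘(ℝ, E) 𝓘(ℝ, A) ∞ ψ (χ 1) :=
      (hψs.contDiffAt (extChartAt_target_mem_nhds (I := 𝓘(ℝ, E)) (1 : G))).contMDiffAt
    refine (h2.comp (1 : G) (contMDiffAt_extChartAt (I := 𝓘(ℝ, E)))).congr_of_eventuallyEq ?_
    filter_upwards [extChartAt_source_mem_nhds (I := 𝓘(ℝ, E)) (1 : G)] with g hg
    simp only [ψ, Function.comp_apply]
    rw [χ.left_inv hg]
  -- Translation to an arbitrary point: `ρ(x) = ρ(g) ρ(g⁻¹ x)`.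
  intro g
  have h2 : ContMDiffAt 𝓘(ℝ, E) 𝓘(ℝ, E) ∞ (fun x : G => g⁻¹ * x) g :=
    contMDiff_mul_left.contMDiffAt
  have h3 : ContMDiffAt 𝓘(ℝ, E) 𝓘(ℝ, A) ∞ (fun x : G => ρ (g⁻¹ * x)) g := by
    refine ContMDiffAt.comp_of_eq (g := ρ) (y := 1) h1 h2 ?_
    simp
  have h4 : ContMDiffAt 𝓘(ℝ, E) 𝓘(ℝ, A) ∞
      (fun x : G => ContinuousLinearMap.mul ℝ A (ρ g) (ρ (g⁻¹ * x))) g :=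
    (ContinuousLinearMap.mul ℝ A (ρ g)).contMDiff.contMDiffAt.comp g h3
  refine h4.congr_of_eventuallyEq (Eventually.of_forall fun x => ?_)
  simp [← map_mul]

end Representation

/-! ### Smoothness of slice coordinates, charts and quotient maps -/

namespace BanachLieSubgroup

variable {EA EB GA F : Type*} [NormedAddCommGroup EA] [NormedSpace ℝ EA] [CompleteSpace EA]
  [NormedAddCommGroup EB] [NormedSpace ℝ EB] [TopologicalSpace GA] [ChartedSpace EA GA] [Group GA]
  [LieGroup 𝓘(ℝ, EA) ∞ GA] [NormedAddCommGroup F] [NormedSpace ℂ F]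
  (S : BanachLieSubgroup EA EB GA) (ρ : S.toSubgroup →ₜ* (F →L[ℂ] F))

/-- The inclusion of the subgroup is an immersion, so smoothness of a continuous map into the
subgroup can be tested in `GA`. -/
theorem contMDiffAt_of_comp_val {V M : Type*} [NormedAddCommGroup V] [NormedSpace ℝ V]
    [TopologicalSpace M] [ChartedSpace V M] {f : M → S.toSubgroup} {x : M} (hf : ContinuousAt f x)
    (h : ContMDiffAt 𝓘(ℝ, V) 𝓘(ℝ, EA) ∞ (fun y => (f y : GA)) x) :
    ContMDiffAt 𝓘(ℝ, V) 𝓘(ℝ, EB) ∞ f x :=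
  (ContMDiffAt.iff_comp_isImmersionAtOfComplement
    (S.isSmoothEmbedding.isImmersion.isImmersionOfComplement_complement (f x))).2 ⟨hf, h⟩

theorem contMDiff_val : ContMDiff 𝓘(ℝ, EB) 𝓘(ℝ, EA) ∞ (Subtype.val : S.toSubgroup → GA) :=
  S.isSmoothEmbedding.contMDiff

variable {S}

/-- As an element of `GA` the fibre component is the smooth expression `σ(r g)⁻¹ g`; its continuity
into the subgroup is already known. -/
theorem Slice.contMDiffOn_fib (T : S.Slice) :
    ContMDiffOn 𝓘(ℝ, EA) 𝓘(ℝ, EB) ∞ T.fib T.W := by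
  intro g hg
  have hW : T.W ∈ 𝓝 g := T.isOpen_W.mem_nhds hg
  refine ContMDiffAt.contMDiffWithinAt (S.contMDiffAt_of_comp_val
    (T.continuousOn_fib.continuousAt hW) ?_)
  have h1 : ContMDiffOn 𝓘(ℝ, EA) 𝓘(ℝ, EA) ∞ (fun g => (T.σ (T.r g))⁻¹ * g) T.W :=
    (T.smooth_σ.comp T.smooth_r (fun g hg => T.r_mem hg)).inv.mul contMDiffOn_id
  exact (h1.congr fun g hg => T.coe_fib hg).contMDiffAt hW

theorem Slice.fib_of_mem (T : S.Slice) {w : GA} (hw : w ∈ S.toSubgroup) : T.fib w = ⟨w, hw⟩ := by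
  have h1 : T.σ 0 * w = w := by rw [T.σ_zero, one_mul]
  have hW : w ∈ T.W := ⟨0, T.zero_mem, w, hw, h1.symm⟩
  have hr := T.r_eq 0 T.zero_mem w hw
  rw [h1] at hr
  ext
  rw [T.coe_fib hW, hr, T.σ_zero]
  simp

theorem Slice.fib_σ_mul (T : S.Slice) {c : S.Normal} (hc : c ∈ T.U) (w : S.toSubgroup) :
    T.fib (T.σ c * w) = w := by
  ext
  rw [T.coe_fib ⟨c, hc, w, w.2, rfl⟩, T.r_eq c hc w w.2]
  simp

variable (S)

/-- The representation `ρ`, with values in the real Banach algebra of real linear operators. -/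
def realRep : S.toSubgroup →* (F →L[ℝ] F) where
  toFun w := (ρ w).restrictScalars ℝ
  map_one' := by simp; rfl
  map_mul' w w' := by simp; rfl

theorem realRep_apply (w : S.toSubgroup) (f : F) : S.realRep ρ w f = ρ w f := rfl

/-- This is where norm continuity of `ρ` becomes smoothness; every chart of `D` depends on it. -/
theorem contMDiff_realRep [CompleteSpace F] :
    ContMDiff 𝓘(ℝ, EB) 𝓘(ℝ, F →L[ℝ] F) ∞ (S.realRep ρ) :=
  (S.realRep ρ).contMDiff_of_continuous
    ((ContinuousLinearMap.restrictScalarsL ℂ F F ℝ ℝ).continuous.comp ρ.continuous_toFun)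

/-! ### The homogeneous space -/

/-- The coordinate of `G_A / G_B` around `g₀ G_B`, lifted to `G_A`. -/
def baseCoord (g₀ g : GA) : S.Normal := S.slice.r (g₀⁻¹ * g)

theorem contMDiffOn_baseCoord (g₀ : GA) : ContMDiffOn 𝓘(ℝ, EA) 𝓘(ℝ, S.Normal) ∞
    (S.baseCoord g₀) {g | g₀⁻¹ * g ∈ S.slice.W} :=
  S.slice.smooth_r.comp contMDiff_mul_left.contMDiffOn (fun _ hg => hg)

theorem isOpen_translate_W (g₀ : GA) : IsOpen {g : GA | g₀⁻¹ * g ∈ S.slice.W} :=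
  have : IsTopologicalGroup GA := topologicalGroup_of_lieGroup 𝓘(ℝ, EA) ∞
  S.slice.isOpen_W.preimage (continuous_const_mul g₀⁻¹)

theorem self_mem_translate_W (g₀ : GA) : g₀⁻¹ * g₀ ∈ S.slice.W := by
  simpa [S.slice.σ_zero] using S.slice.σ_mem S.slice.zero_mem

theorem contMDiffOn_mul_σ (g₀ : GA) : ContMDiffOn 𝓘(ℝ, S.Normal) 𝓘(ℝ, EA) ∞
    (fun c => g₀ * S.slice.σ c) S.slice.U :=
  contMDiff_mul_left.comp_contMDiffOn S.slice.smooth_σ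

/-- The set `W` is stable under right multiplication by the subgroup, so the criterion does not
depend on the representative. -/
theorem mem_baseChart_source {g₀ g : GA} :
    S.coset g ∈ (S.baseChart g₀).source ↔ g₀⁻¹ * g ∈ S.slice.W := by
  constructor
  · rintro ⟨g', hg', h⟩
    have := (S.slice.mul_mem_W hg' (S.coset_eq_iff.1 h)).1
    simpa [mul_assoc] using this
  · exact fun h => ⟨g, h, rfl⟩

theorem baseChart_coset {g₀ g : GA} (hg : g₀⁻¹ * g ∈ S.slice.W) :
    S.baseChart g₀ (S.coset g) = S.baseCoord g₀ g := by
  set g' := surjInv S.isOpenQuotientMap_coset.surjective (S.coset g) with hg'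
  have h : S.coset g = S.coset g' := (surjInv_eq S.isOpenQuotientMap_coset.surjective _).symm
  have h2 := (S.slice.mul_mem_W hg (S.coset_eq_iff.1 h)).2
  change S.slice.r (g₀⁻¹ * g') = S.slice.r (g₀⁻¹ * g)
  rw [← h2]
  congr 1
  group

/-- The transition maps are `c ↦ r(g₁⁻¹ g₀ σ(c))`, composites of smooth maps through `GA`. -/
theorem isManifold_base : IsManifold 𝓘(ℝ, S.Normal) ∞ S.Base := by
  refine isManifold_of_contDiffOn _ _ _ ?_
  rintro _ _ ⟨g₀, rfl⟩ ⟨g₁, rfl⟩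
  simp only [mfld_simps]
  rw [← contMDiffOn_iff_contDiffOn]
  have h1 : ∀ c ∈ (S.baseChart g₀).target ∩ (S.baseChart g₀).symm ⁻¹' (S.baseChart g₁).source,
      c ∈ S.slice.U ∧ g₁⁻¹ * (g₀ * S.slice.σ c) ∈ S.slice.W := by
    rintro c ⟨hc, hc'⟩
    exact ⟨hc, S.mem_baseChart_source.1 hc'⟩
  refine ((S.contMDiffOn_baseCoord g₁).comp ((S.contMDiffOn_mul_σ g₀).mono fun c hc => (h1 c hc).1)
    (fun c hc => (h1 c hc).2)).congr fun c hc => ?_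
  exact S.baseChart_coset (h1 c hc).2

/-! ### The homogeneous bundle -/

/-- The coordinate of the bundle around the fibre of `g₀ G_B`, lifted to `G_A × F`. -/
def bundleCoord (g₀ : GA) (p : GA × F) : S.Normal × F :=
  (S.slice.r (g₀⁻¹ * p.1), ρ (S.slice.fib (g₀⁻¹ * p.1)) p.2)

/-- The lift to `G_A × F` of the inverse of a bundle chart. -/
def bundleSec (g₀ : GA) (x : S.Normal × F) : GA × F := (g₀ * S.slice.σ x.1, x.2)

/-- From `[(σ(c) w, f)] = [(σ(c), ρ(w) f)]`, the fibre coordinate involves `ρ ∘ fib`, whose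
smoothness combines that of the representation with that of the slice. -/
theorem contMDiffOn_bundleCoord [CompleteSpace F] (g₀ : GA) :
    ContMDiffOn (𝓘(ℝ, EA).prod 𝓘(ℝ, F)) 𝓘(ℝ, S.Normal × F) ∞ (S.bundleCoord ρ g₀)
      {p | g₀⁻¹ * p.1 ∈ S.slice.W} := by
  refine ContMDiffOn.prodMk_space ?_ ?_
  · exact (S.contMDiffOn_baseCoord g₀).comp contMDiff_fst.contMDiffOn (fun _ hp => hp)
  · have h1 : ContMDiffOn (𝓘(ℝ, EA).prod 𝓘(ℝ, F)) 𝓘(ℝ, F →L[ℝ] F) ∞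
        (fun p : GA × F => S.realRep ρ (S.slice.fib (g₀⁻¹ * p.1))) {p | g₀⁻¹ * p.1 ∈ S.slice.W} := by
      refine (S.contMDiff_realRep ρ).comp_contMDiffOn (S.slice.contMDiffOn_fib.comp
        (t := S.slice.W) ?_ (fun _ hp => hp))
      exact (contMDiff_mul_left.comp contMDiff_fst).contMDiffOn
    exact h1.clm_apply contMDiff_snd.contMDiffOn

theorem contMDiffOn_bundleSec (g₀ : GA) :
    ContMDiffOn 𝓘(ℝ, S.Normal × F) (𝓘(ℝ, EA).prod 𝓘(ℝ, F)) ∞ (S.bundleSec (F := F) g₀)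
      (S.slice.U ×ˢ univ) := by
  refine ContMDiffOn.prodMk ?_ contDiff_snd.contMDiff.contMDiffOn
  exact (S.contMDiffOn_mul_σ g₀).comp contDiff_fst.contMDiff.contMDiffOn (fun x hx => hx.1)

theorem isOpen_translate_W_prod (g₀ : GA) : IsOpen {p : GA × F | g₀⁻¹ * p.1 ∈ S.slice.W} :=
  (S.isOpen_translate_W g₀).preimage continuous_fst

theorem mem_bundleChart_source {g₀ : GA} {p : GA × F} :
    S.cls ρ p ∈ (S.bundleChart ρ g₀).source ↔ g₀⁻¹ * p.1 ∈ S.slice.W := by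
  constructor
  · rintro ⟨p', hp', h⟩
    obtain ⟨w, h1, -⟩ := (S.cls_eq_iff ρ).1 h
    have := (S.slice.mul_mem_W hp' w.2).1
    rwa [mul_assoc, ← h1] at this
  · exact fun h => ⟨p, h, rfl⟩

theorem bundleCoord_congr {g₀ : GA} {p p' : GA × F} (hp : g₀⁻¹ * p.1 ∈ S.slice.W)
    (h : S.cls ρ p = S.cls ρ p') : S.bundleCoord ρ g₀ p' = S.bundleCoord ρ g₀ p := by
  obtain ⟨w, h1, h2⟩ := (S.cls_eq_iff ρ).1 h
  have h3 := S.slice.mul_mem_W hp w.2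
  have h4 : g₀⁻¹ * p'.1 = g₀⁻¹ * p.1 * w := by rw [h1, mul_assoc]
  have h5 : S.slice.fib (g₀⁻¹ * p'.1) = S.slice.fib (g₀⁻¹ * p.1) * w := by
    ext
    rw [Subgroup.coe_mul, S.slice.coe_fib hp, h4, S.slice.coe_fib h3.1, h3.2]
    simp only [mul_assoc]
  ext1
  · dsimp only [bundleCoord]
    rw [h4, h3.2]
  · dsimp only [bundleCoord]
    rw [h5, h2, ← mul_apply_eq_comp, ← map_mul]
    simp

theorem bundleChart_cls {g₀ : GA} {p : GA × F} (hp : g₀⁻¹ * p.1 ∈ S.slice.W) :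
    S.bundleChart ρ g₀ (S.cls ρ p) = S.bundleCoord ρ g₀ p :=
  S.bundleCoord_congr ρ hp (surjInv_eq (S.isOpenQuotientMap_cls ρ).surjective _).symm

theorem bundleChart_symm_apply (g₀ : GA) (x : S.Normal × F) :
    (S.bundleChart ρ g₀).symm x = S.cls ρ (S.bundleSec g₀ x) := rfl

theorem isManifold_homogeneousBundle [CompleteSpace F] :
    IsManifold 𝓘(ℝ, S.Normal × F) ∞ (S.HomogeneousBundle ρ) := by
  refine isManifold_of_contDiffOn _ _ _ ?_
  rintro _ _ ⟨g₀, rfl⟩ ⟨g₁, rfl⟩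
  simp only [mfld_simps]
  rw [← contMDiffOn_iff_contDiffOn]
  have h1 : ∀ c ∈ (S.bundleChart ρ g₀).target ∩
      (S.bundleChart ρ g₀).symm ⁻¹' (S.bundleChart ρ g₁).source,
      c ∈ S.slice.U ×ˢ (univ : Set F) ∧ g₁⁻¹ * (S.bundleSec g₀ c).1 ∈ S.slice.W := by
    rintro c ⟨hc, hc'⟩
    exact ⟨hc, (S.mem_bundleChart_source ρ).1 hc'⟩
  refine ((S.contMDiffOn_bundleCoord ρ g₁).comp
    ((S.contMDiffOn_bundleSec g₀).mono fun c hc => (h1 c hc).1)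
    (fun c hc => (h1 c hc).2)).congr fun c hc => ?_
  exact S.bundleChart_cls ρ (h1 c hc).2

/-! ### Local sections of the quotient maps -/

theorem contMDiffOn_baseChart (g₀ : GA) : ContMDiffOn 𝓘(ℝ, S.Normal) 𝓘(ℝ, S.Normal) ∞
    (S.baseChart g₀) (S.baseChart g₀).source :=
  have := S.isManifold_base
  contMDiffOn_of_mem_maximalAtlas (IsManifold.subset_maximalAtlas (mem_range_self g₀))

theorem contMDiffOn_baseChart_symm (g₀ : GA) : ContMDiffOn 𝓘(ℝ, S.Normal) 𝓘(ℝ, S.Normal) ∞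
    (S.baseChart g₀).symm S.slice.U :=
  have := S.isManifold_base
  contMDiffOn_symm_of_mem_maximalAtlas (IsManifold.subset_maximalAtlas (mem_range_self g₀))

theorem contMDiff_coset : ContMDiff 𝓘(ℝ, EA) 𝓘(ℝ, S.Normal) ∞ S.coset := by
  intro g
  have hg := S.self_mem_translate_W g
  have hn := (S.isOpen_translate_W g).mem_nhds hg
  have h2 := (S.contMDiffOn_baseChart_symm g).comp (S.contMDiffOn_baseCoord g)
    (fun g' hg' => S.slice.r_mem hg')
  refine (h2.congr fun g' hg' => ?_).contMDiffAt hn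
  rw [comp_apply, ← S.baseChart_coset hg']
  exact ((S.baseChart g).left_inv (S.mem_baseChart_source.2 hg')).symm

/-- Local sections reduce smoothness of a map out of the quotient to smoothness of its lift to `GA`.
-/
theorem exists_localSection_coset (g : GA) : ∃ s : S.Base → GA,
    ContMDiffAt 𝓘(ℝ, S.Normal) 𝓘(ℝ, EA) ∞ s (S.coset g) ∧ s (S.coset g) = g ∧
      ∀ᶠ y in 𝓝 (S.coset g), S.coset (s y) = y := by
  have hg := S.self_mem_translate_W g
  have hs := S.mem_baseChart_source.2 hg
  have hn := (S.baseChart g).open_source.mem_nhds hs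
  refine ⟨fun y => g * S.slice.σ (S.baseChart g y), ?_, ?_, ?_⟩
  · exact ((S.contMDiffOn_mul_σ g).comp (S.contMDiffOn_baseChart g)
      (fun y hy => (S.baseChart g).map_source hy)).contMDiffAt hn
  · dsimp only
    rw [S.baseChart_coset hg]
    have := S.slice.r_σ S.slice.zero_mem
    rw [S.slice.σ_zero] at this
    simp [baseCoord, this, S.slice.σ_zero]
  · filter_upwards [hn] with y hy
    exact (S.baseChart g).left_inv hy

section

variable [CompleteSpace F]

theorem contMDiffOn_bundleChart (g₀ : GA) : ContMDiffOn 𝓘(ℝ, S.Normal × F) 𝓘(ℝ, S.Normal × F) ∞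
    (S.bundleChart ρ g₀) (S.bundleChart ρ g₀).source :=
  have := S.isManifold_homogeneousBundle ρ
  contMDiffOn_of_mem_maximalAtlas (IsManifold.subset_maximalAtlas (mem_range_self g₀))

theorem contMDiffOn_bundleChart_symm (g₀ : GA) :
    ContMDiffOn 𝓘(ℝ, S.Normal × F) 𝓘(ℝ, S.Normal × F) ∞
      (S.bundleChart ρ g₀).symm (S.slice.U ×ˢ univ) :=
  have := S.isManifold_homogeneousBundle ρ
  contMDiffOn_symm_of_mem_maximalAtlas (IsManifold.subset_maximalAtlas (mem_range_self g₀))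

theorem contMDiff_cls : ContMDiff (𝓘(ℝ, EA).prod 𝓘(ℝ, F)) 𝓘(ℝ, S.Normal × F) ∞ (S.cls ρ) := by
  intro p
  have hp := S.self_mem_translate_W p.1
  have hn := (S.isOpen_translate_W_prod (F := F) p.1).mem_nhds hp
  have h2 := (S.contMDiffOn_bundleChart_symm ρ p.1).comp (S.contMDiffOn_bundleCoord ρ p.1)
    (fun p' hp' => ⟨S.slice.r_mem hp', mem_univ _⟩)
  refine (h2.congr fun p' hp' => ?_).contMDiffAt hn
  rw [comp_apply, ← S.bundleChart_cls ρ hp']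
  exact ((S.bundleChart ρ p.1).left_inv ((S.mem_bundleChart_source ρ).2 hp')).symm

theorem exists_localSection_cls (p : GA × F) : ∃ s : S.HomogeneousBundle ρ → GA × F,
    ContMDiffAt 𝓘(ℝ, S.Normal × F) (𝓘(ℝ, EA).prod 𝓘(ℝ, F)) ∞ s (S.cls ρ p) ∧
      s (S.cls ρ p) = p ∧ ∀ᶠ y in 𝓝 (S.cls ρ p), S.cls ρ (s y) = y := by
  have hp := S.self_mem_translate_W p.1
  have hs := (S.mem_bundleChart_source ρ).2 hp
  have hn := (S.bundleChart ρ p.1).open_source.mem_nhds hs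
  refine ⟨fun y => S.bundleSec p.1 (S.bundleChart ρ p.1 y), ?_, ?_, ?_⟩
  · exact ((S.contMDiffOn_bundleSec p.1).comp (S.contMDiffOn_bundleChart ρ p.1)
      (fun y hy => (S.bundleChart ρ p.1).map_source hy)).contMDiffAt hn
  · dsimp only
    rw [S.bundleChart_cls ρ hp]
    have := S.slice.r_σ S.slice.zero_mem
    rw [S.slice.σ_zero] at this
    have h1 : S.slice.fib (1 : GA) = 1 := S.slice.fib_of_mem (one_mem _)
    simp [bundleCoord, bundleSec, this, S.slice.σ_zero, h1]
  · filter_upwards [hn] with y hy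
    exact (S.bundleChart ρ p.1).left_inv hy

end

end BanachLieSubgroup

/-! ### Calculus of derivatives between model spaces -/

section HasTangentMapAt

variable {E E' E'' H H' H'' M M' M'' : Type*}
  [NormedAddCommGroup E] [NormedSpace ℝ E] [TopologicalSpace H]
  [NormedAddCommGroup E'] [NormedSpace ℝ E'] [TopologicalSpace H']
  [NormedAddCommGroup E''] [NormedSpace ℝ E''] [TopologicalSpace H'']
  (I : ModelWithCorners ℝ E H) (I' : ModelWithCorners ℝ E' H') (I'' : ModelWithCorners ℝ E'' H'')
  [TopologicalSpace M] [ChartedSpace H M] [TopologicalSpace M'] [ChartedSpace H' M']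
  [TopologicalSpace M''] [ChartedSpace H'' M'']

/-- `L` is the derivative of `f` at `x`, as a map between the model spaces (with which the tangent
spaces are identified). -/
def HasTangentMapAt (f : M → M') (x : M) (L : E →L[ℝ] E') : Prop :=
  HasMFDerivAt I I' f x (L : TangentSpace I x →L[ℝ] TangentSpace I' (f x))

variable {I I' I''}

theorem ContMDiffAt.exists_hasTangentMapAt {f : M → M'} {x : M} (hf : ContMDiffAt I I' ∞ f x) :
    ∃ L : E →L[ℝ] E', HasTangentMapAt I I' f x L :=
  ⟨mfderiv I I' f x, (hf.mdifferentiableAt (by simp)).hasMFDerivAt⟩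

namespace HasTangentMapAt

theorem mfderiv_apply {f : M → M'} {x : M} {L : E →L[ℝ] E'} (h : HasTangentMapAt I I' f x L)
    (v : E) : (mfderiv I I' f x : E →L[ℝ] E') v = L v :=
  congrArg (fun T : E →L[ℝ] E' => T v) (HasMFDerivAt.mfderiv h)

theorem tangentMap_mk {f : M → M'} {x : M} {L : E →L[ℝ] E'} (h : HasTangentMapAt I I' f x L)
    (v : E) : tangentMap I I' f ⟨x, v⟩ = ⟨f x, L v⟩ :=
  congrArg (fun w : E' => (⟨f x, w⟩ : TangentBundle I' M')) (h.mfderiv_apply v)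

theorem unique {f : M → M'} {x : M} {L L' : E →L[ℝ] E'} (h : HasTangentMapAt I I' f x L)
    (h' : HasTangentMapAt I I' f x L') : L = L' :=
  hasMFDerivAt_unique h h'

theorem congr {f g : M → M'} {x : M} {L : E →L[ℝ] E'} (h : HasTangentMapAt I I' f x L)
    (hg : g =ᶠ[𝓝 x] f) : HasTangentMapAt I I' g x L :=
  HasMFDerivAt.congr_of_eventuallyEq h hg

/-- The base points need agree only up to a proven equality, which absorbs identities such as `g * 1
= g` without transport between tangent spaces. -/
theorem comp {f : M → M'} {g : M' → M''} {x : M} {y : M'} {L : E →L[ℝ] E'} {L' : E' →L[ℝ] E''}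
    (hg : HasTangentMapAt I' I'' g y L') (hf : HasTangentMapAt I I' f x L) (hy : f x = y) :
    HasTangentMapAt I I'' (fun z => g (f z)) x (L'.comp L) := by
  subst hy
  exact HasMFDerivAt.comp x hg hf

theorem id (x : M) : HasTangentMapAt I I (fun y => y) x (.id ℝ E) := hasMFDerivAt_id x

theorem const (x : M) (c : M') : HasTangentMapAt I I' (fun _ => c) x 0 := hasMFDerivAt_const c x

theorem fst (p : M × M') : HasTangentMapAt (I.prod I') I Prod.fst p (.fst ℝ E E') :=
  hasMFDerivAt_fst p

theorem snd (p : M × M') : HasTangentMapAt (I.prod I') I' Prod.snd p (.snd ℝ E E') :=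
  hasMFDerivAt_snd p

theorem prodMk {f : M → M'} {g : M → M''} {x : M} {L : E →L[ℝ] E'} {L' : E →L[ℝ] E''}
    (hf : HasTangentMapAt I I' f x L) (hg : HasTangentMapAt I I'' g x L') :
    HasTangentMapAt I (I'.prod I'') (fun y => (f y, g y)) x (L.prod L') :=
  HasMFDerivAt.prodMk hf hg

theorem prodMk_space {f : M → E'} {g : M → E''} {x : M} {L : E →L[ℝ] E'} {L' : E →L[ℝ] E''}
    (hf : HasTangentMapAt I 𝓘(ℝ, E') f x L) (hg : HasTangentMapAt I 𝓘(ℝ, E'') g x L') :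
    HasTangentMapAt I 𝓘(ℝ, E' × E'') (fun y => (f y, g y)) x (L.prod L') :=
  ⟨hf.1.prodMk hg.1, hf.2.prodMk hg.2⟩

theorem of_hasFDerivAt {f : E → E'} {x : E} {L : E →L[ℝ] E'} (h : HasFDerivAt f L x) :
    HasTangentMapAt 𝓘(ℝ, E) 𝓘(ℝ, E') f x L :=
  h.hasMFDerivAt

theorem clm_apply {A : M → E' →L[ℝ] E''} {f : M → E'} {x : M} {L : E →L[ℝ] E' →L[ℝ] E''}
    {L' : E →L[ℝ] E'} (hA : HasTangentMapAt I 𝓘(ℝ, E' →L[ℝ] E'') A x L)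
    (hf : HasTangentMapAt I 𝓘(ℝ, E') f x L') :
    HasTangentMapAt I 𝓘(ℝ, E'') (fun y => A y (f y)) x ((A x).comp L' + L.flip (f x)) := by
  have h1 : HasFDerivAt (fun q : (E' →L[ℝ] E'') × E' => q.1 q.2) _ (A x, f x) :=
    hasFDerivAt_fst.clm_apply hasFDerivAt_snd
  convert (of_hasFDerivAt h1).comp (hA.prodMk_space hf) rfl using 1
  ext v
  simp

end HasTangentMapAt

theorem TangentBundle.mk_eq_mk {x y : M} (h : x = y) {v w : E} (hv : v = w) :
    (⟨x, v⟩ : TangentBundle I M) = ⟨y, w⟩ := by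
  subst h hv
  rfl

theorem TangentBundle.mk_eq_mk_iff {x : M} {v w : E} :
    (⟨x, v⟩ : TangentBundle I M) = ⟨x, w⟩ ↔ v = w :=
  ⟨fun h => eq_of_heq (Bundle.TotalSpace.mk.inj h).2, TangentBundle.mk_eq_mk rfl⟩

end HasTangentMapAt

/-! ### Tangent maps of the quotient maps and vertical vectors -/

namespace BanachLieSubgroup

variable {EA EB GA F : Type*} [NormedAddCommGroup EA] [NormedSpace ℝ EA] [CompleteSpace EA]
  [NormedAddCommGroup EB] [NormedSpace ℝ EB] [TopologicalSpace GA] [ChartedSpace EA GA] [Group GA]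
  [LieGroup 𝓘(ℝ, EA) ∞ GA] [NormedAddCommGroup F] [NormedSpace ℂ F]
  (S : BanachLieSubgroup EA EB GA) (ρ : S.toSubgroup →ₜ* (F →L[ℂ] F))

theorem exists_hasTangentMapAt_val : ∃ ι : EB →L[ℝ] EA,
    HasTangentMapAt 𝓘(ℝ, EB) 𝓘(ℝ, EA) (Subtype.val : S.toSubgroup → GA) 1 ι ∧
      ∀ X : EA, X ∈ S.lieSubalgebra ↔ ∃ b, ι b = X := by
  obtain ⟨ι, hι⟩ := S.contMDiff_val.contMDiffAt.exists_hasTangentMapAt (x := (1 : S.toSubgroup))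
  refine ⟨ι, hι, fun X => ?_⟩
  constructor
  · rintro ⟨b, hb⟩
    exact ⟨b, (hι.mfderiv_apply b).symm.trans hb⟩
  · rintro ⟨b, hb⟩
    exact ⟨b, (hι.mfderiv_apply b).trans hb⟩

theorem exists_hasTangentMapAt_coset (g : GA) : ∃ N : EA →L[ℝ] S.Normal,
    HasTangentMapAt 𝓘(ℝ, EA) 𝓘(ℝ, S.Normal) (fun x => S.coset (g * x)) 1 N :=
  (S.contMDiff_coset.comp contMDiff_mul_left).contMDiffAt.exists_hasTangentMapAt

/-- The kernel of the tangent map of `G_A → G_A / G_B`, in the left trivialization, is `𝔤_B`. -/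
theorem hasTangentMapAt_coset_eq_zero_iff {g : GA} {N : EA →L[ℝ] S.Normal}
    (hN : HasTangentMapAt 𝓘(ℝ, EA) 𝓘(ℝ, S.Normal) (fun x => S.coset (g * x)) 1 N) (X : EA) :
    N X = 0 ↔ X ∈ S.lieSubalgebra := by
  obtain ⟨ι, hι, hιX⟩ := S.exists_hasTangentMapAt_val
  rw [hιX]
  constructor
  · intro hX
    have h1W : (1 : GA) ∈ S.slice.W := ⟨0, S.slice.zero_mem, 1, one_mem _, by simp [S.slice.σ_zero]⟩
    have hnW : S.slice.W ∈ 𝓝 (1 : GA) := S.slice.isOpen_W.mem_nhds h1W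
    have hr1 : S.slice.r 1 = 0 := by
      simpa [S.slice.σ_zero] using S.slice.r_σ S.slice.zero_mem
    have hf1 : S.slice.fib 1 = 1 := S.slice.fib_of_mem (one_mem _)
    obtain ⟨b, hb⟩ := (S.slice.contMDiffOn_fib.contMDiffAt hnW).exists_hasTangentMapAt
    obtain ⟨e, he⟩ := ((S.contMDiffOn_baseChart g).contMDiffAt ((S.baseChart g).open_source.mem_nhds
      (S.mem_baseChart_source.2 (S.self_mem_translate_W g)))).exists_hasTangentMapAt
    -- The slice coordinate factors through the quotient, so its derivative kills `X` as soon as `N`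
    -- does.
    have hr : HasTangentMapAt 𝓘(ℝ, EA) 𝓘(ℝ, S.Normal) S.slice.r 1 (e.comp N) := by
      refine (he.comp hN (by simp)).congr ?_
      filter_upwards [hnW] with x hx
      rw [S.baseChart_coset (by simpa using hx)]
      simp [baseCoord]
    let m : S.Normal × S.toSubgroup → GA := fun q => S.slice.σ q.1 * q.2
    have hm : ContMDiffAt (𝓘(ℝ, S.Normal).prod 𝓘(ℝ, EB)) 𝓘(ℝ, EA) ∞ m (0, 1) := by
      refine ContMDiffAt.mul ?_ (S.contMDiff_val.comp contMDiff_snd).contMDiffAt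
      exact ContMDiffAt.comp (f := Prod.fst) _
        (S.slice.smooth_σ.contMDiffAt (S.slice.isOpen_U.mem_nhds S.slice.zero_mem)) contMDiffAt_fst
    obtain ⟨μ, hμ⟩ := hm.exists_hasTangentMapAt
    -- Differentiate `x = σ(r x) · fib x` at `1`. When `N X = 0`, only the subgroup factor
    -- contributes, and `X = ι (b X)`.
    have h1 : μ.comp ((e.comp N).prod b) = .id ℝ EA := by
      refine HasTangentMapAt.unique (hμ.comp (hr.prodMk hb) (by rw [hr1, hf1]))
        ((HasTangentMapAt.id (1 : GA)).congr ?_)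
      filter_upwards [hnW] with x hx
      simp only [m]
      rw [S.slice.coe_fib hx]
      group
    have h2 : μ.comp ((0 : EB →L[ℝ] S.Normal).prod (.id ℝ EB)) = ι := by
      refine HasTangentMapAt.unique (hμ.comp ((HasTangentMapAt.const (1 : S.toSubgroup)
        (0 : S.Normal)).prodMk (HasTangentMapAt.id (1 : S.toSubgroup))) rfl) ?_
      simpa [m, S.slice.σ_zero] using hι
    refine ⟨b X, ?_⟩
    rw [← h2]
    have h3 := congrArg (fun T : EA →L[ℝ] EA => T X) h1
    simpa [hX] using h3
  · rintro ⟨b, rfl⟩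
    have h : N.comp ι = 0 := by
      refine HasTangentMapAt.unique (hN.comp hι rfl)
        ((HasTangentMapAt.const (1 : S.toSubgroup) (S.coset g)).congr ?_)
      refine Filter.Eventually.of_forall fun w => ?_
      exact (S.coset_eq_iff.2 (by simp)).symm
    exact congrArg (fun T : EB →L[ℝ] S.Normal => T b) h

theorem hasTangentMapAt_lieAd (g : GA) :
    HasTangentMapAt 𝓘(ℝ, EA) 𝓘(ℝ, EA) (fun x : GA => g * x * g⁻¹) 1 (lieAd g) :=
  ((contMDiff_mul_right.comp contMDiff_mul_left).contMDiffAt.mdifferentiableAt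
    (n := ∞) (by simp)).hasMFDerivAt

variable [CompleteSpace F]

theorem exists_hasTangentMapAt_cls (g : GA) (f : F) : ∃ L : EA × F →L[ℝ] S.Normal × F,
    HasTangentMapAt (𝓘(ℝ, EA).prod 𝓘(ℝ, F)) 𝓘(ℝ, S.Normal × F)
      (fun q : GA × F => S.cls ρ (g * q.1, q.2)) (1, f) L :=
  ((S.contMDiff_cls ρ).comp ((contMDiff_mul_left.comp contMDiff_fst).prodMk
    contMDiff_snd)).contMDiffAt.exists_hasTangentMapAt

variable {ρ S}

/-- By the chain rule with `λ_g`; it reduces all later work on tangent vectors of `D` to the single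
linear map `L`. -/
theorem tangentCls_eq {g : GA} {f : F} {L : EA × F →L[ℝ] S.Normal × F}
    (hL : HasTangentMapAt (𝓘(ℝ, EA).prod 𝓘(ℝ, F)) 𝓘(ℝ, S.Normal × F)
      (fun q : GA × F => S.cls ρ (g * q.1, q.2)) (1, f) L) (X : EA) (h : F) :
    S.tangentCls ρ ((g, X), (f, h)) = ⟨S.cls ρ (g, f), L (X, h)⟩ := by
  obtain ⟨T, hT⟩ := (S.contMDiff_cls ρ).contMDiffAt.exists_hasTangentMapAt (x := (g, f))
  obtain ⟨Λ, hΛ⟩ := (contMDiff_mul_left (I := 𝓘(ℝ, EA)) (n := ∞)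
    (a := g)).contMDiffAt.exists_hasTangentMapAt (x := (1 : GA))
  have h1 : L = T.comp ((Λ.comp (.fst ℝ EA F)).prod (.snd ℝ EA F)) :=
    hL.unique (hT.comp ((hΛ.comp (HasTangentMapAt.fst (1, f)) rfl).prodMk
      (HasTangentMapAt.snd (1, f))) (by simp))
  have h2 : S.tangentCls ρ ((g, X), (f, h)) = ⟨S.cls ρ (g, f), T (Λ X, h)⟩ := by
    rw [← hT.tangentMap_mk, ← hΛ.mfderiv_apply]
    rfl
  rw [h2, h1]
  rfl

variable (ρ S)

/-- Since `[(g w x, k)] = [(g (w x w⁻¹), ρ(w) k)]`, differentiating at `x = 1` turns a change of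
representative into `Ad(w)` on the Lie algebra and `ρ(w)` on the fibre. -/
theorem tangentCls_mul (g : GA) (w : S.toSubgroup) (X : GroupLieAlgebra 𝓘(ℝ, EA) GA) (f h : F) :
    S.tangentCls ρ ((g * w, X), (f, h)) =
      S.tangentCls ρ ((g, lieAd (w : GA) X), (ρ w f, ρ w h)) := by
  have hcls : ∀ (x : GA) (k : F), S.cls ρ (g * w * x, k) = S.cls ρ (g * (w * x * w⁻¹), ρ w k) := by
    intro x k
    rw [cls_eq_iff]
    refine ⟨w⁻¹, by simp [mul_assoc], by simp⟩
  obtain ⟨L, hL⟩ := S.exists_hasTangentMapAt_cls ρ g (ρ w f)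
  let A : EA →L[ℝ] EA := lieAd (w : GA)
  have hA : HasTangentMapAt 𝓘(ℝ, EA) 𝓘(ℝ, EA) (fun x : GA => w * x * (w : GA)⁻¹) 1 A :=
    hasTangentMapAt_lieAd (w : GA)
  have hρ : HasTangentMapAt 𝓘(ℝ, F) 𝓘(ℝ, F) (S.realRep ρ w) f (S.realRep ρ w) :=
    .of_hasFDerivAt (S.realRep ρ w).hasFDerivAt
  have hL' : HasTangentMapAt (𝓘(ℝ, EA).prod 𝓘(ℝ, F)) 𝓘(ℝ, S.Normal × F)
      (fun q : GA × F => S.cls ρ (g * w * q.1, q.2)) (1, f)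
      (L.comp ((A.comp (.fst ℝ EA F)).prod ((S.realRep ρ w).comp (.snd ℝ EA F)))) := by
    refine (hL.comp ((hA.comp (HasTangentMapAt.fst (1, f)) rfl).prodMk
      (hρ.comp (HasTangentMapAt.snd (1, f)) rfl)) ?_).congr
      (Filter.Eventually.of_forall fun q => hcls q.1 q.2)
    simp [realRep_apply]
  refine (tangentCls_eq hL' X h).trans (Eq.trans ?_ (tangentCls_eq hL (A X) (ρ w h)).symm)
  refine TangentBundle.mk_eq_mk ?_ rfl
  simpa using hcls 1 f

/-- The right inverse is the derivative of a local section, translated back to `1`. -/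
theorem exists_rightInverse_of_hasTangentMapAt_cls {g : GA} {f : F}
    {L : EA × F →L[ℝ] S.Normal × F}
    (hL : HasTangentMapAt (𝓘(ℝ, EA).prod 𝓘(ℝ, F)) 𝓘(ℝ, S.Normal × F)
      (fun q : GA × F => S.cls ρ (g * q.1, q.2)) (1, f) L) :
    ∃ T : S.Normal × F →L[ℝ] EA × F, ∀ v, L (T v) = v := by
  obtain ⟨s, hs, hsx, hcs⟩ := S.exists_localSection_cls ρ (g, f)
  have hs' : ContMDiffAt 𝓘(ℝ, S.Normal × F) (𝓘(ℝ, EA).prod 𝓘(ℝ, F)) ∞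
      (fun y => (g⁻¹ * (s y).1, (s y).2)) (S.cls ρ (g, f)) :=
    ((contMDiff_mul_left.comp contMDiff_fst).contMDiffAt.comp _ hs).prodMk
      (contMDiff_snd.contMDiffAt.comp _ hs)
  obtain ⟨T, hT⟩ := hs'.exists_hasTangentMapAt
  have h1 : L.comp T = .id ℝ (S.Normal × F) := by
    refine HasTangentMapAt.unique (hL.comp hT (by rw [hsx]; simp))
      ((HasTangentMapAt.id (S.cls ρ (g, f))).congr ?_)
    filter_upwards [hcs] with y hy
    simpa using hy
  exact ⟨T, fun v => congrArg (fun Q : S.Normal × F →L[ℝ] S.Normal × F => Q v) h1⟩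

theorem surjective_tangentCls : Surjective (S.tangentCls ρ) := by
  rintro ⟨x, v⟩
  obtain ⟨⟨g, f⟩, rfl⟩ := (S.isOpenQuotientMap_cls ρ).surjective x
  obtain ⟨L, hL⟩ := S.exists_hasTangentMapAt_cls ρ g f
  obtain ⟨T, hT⟩ := S.exists_rightInverse_of_hasTangentMapAt_cls ρ hL
  refine ⟨((g, (T v).1), (f, (T v).2)), ?_⟩
  exact (tangentCls_eq hL _ _).trans (TangentBundle.mk_eq_mk rfl (hT v))

theorem contMDiff_proj : ContMDiff 𝓘(ℝ, S.Normal × F) 𝓘(ℝ, S.Normal) ∞ (S.proj ρ) := by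
  intro x
  obtain ⟨p, rfl⟩ := (S.isOpenQuotientMap_cls ρ).surjective x
  obtain ⟨s, hs, hsx, hcs⟩ := S.exists_localSection_cls ρ p
  refine ((S.contMDiff_coset.comp contMDiff_fst).contMDiffAt.comp _ hs).congr_of_eventuallyEq ?_
  filter_upwards [hcs] with y hy
  conv_lhs => rw [← hy]
  rfl

/-- The tangent map of the bundle projection, on tangent vectors written as `[((g, X), (f, h))]`. -/
theorem hasTangentMapAt_proj_eq_zero_iff {g : GA} {f : F} {L : EA × F →L[ℝ] S.Normal × F}
    (hL : HasTangentMapAt (𝓘(ℝ, EA).prod 𝓘(ℝ, F)) 𝓘(ℝ, S.Normal × F)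
      (fun q : GA × F => S.cls ρ (g * q.1, q.2)) (1, f) L) {P : S.Normal × F →L[ℝ] S.Normal}
    (hP : HasTangentMapAt 𝓘(ℝ, S.Normal × F) 𝓘(ℝ, S.Normal) (S.proj ρ) (S.cls ρ (g, f)) P)
    (v : EA × F) : P (L v) = 0 ↔ v.1 ∈ S.lieSubalgebra := by
  obtain ⟨N, hN⟩ := S.exists_hasTangentMapAt_coset g
  rw [← S.hasTangentMapAt_coset_eq_zero_iff hN]
  -- Both sides differentiate `(x, k) ↦ g x G_B`.
  have h : P.comp L = N.comp (.fst ℝ EA F) :=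
    HasTangentMapAt.unique (hP.comp hL (by simp)) (hN.comp (HasTangentMapAt.fst (1, f)) rfl)
  have h2 : P (L v) = N v.1 := congrArg (fun T : EA × F →L[ℝ] S.Normal => T v) h
  rw [h2]

end BanachLieSubgroup

/-! ### The induced map is a connection -/

namespace ReductiveStructure

variable {EA EB GA F : Type*} [NormedAddCommGroup EA] [NormedSpace ℝ EA] [CompleteSpace EA]
  [NormedAddCommGroup EB] [NormedSpace ℝ EB] [TopologicalSpace GA] [ChartedSpace EA GA] [Group GA]
  [LieGroup 𝓘(ℝ, EA) ∞ GA] [NormedAddCommGroup F] [NormedSpace ℂ F] [CompleteSpace F]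
  (R : ReductiveStructure EA EB GA) (ρ : R.toSubgroup →ₜ* (F →L[ℂ] F))

/-- The projection `E`, as a map of the model space. -/
def modelE : EA →L[ℝ] EA := R.E

theorem modelE_mem (X : EA) : R.modelE X ∈ R.lieSubalgebra := by
  rw [← R.range_E]
  exact ⟨X, rfl⟩

theorem modelE_eq_self_iff (X : EA) : R.modelE X = X ↔ X ∈ R.lieSubalgebra := by
  constructor
  · intro h
    rw [← h]
    exact R.modelE_mem X
  · intro h
    rw [← R.range_E] at h
    obtain ⟨Y, hY⟩ := h
    have := congrArg (fun T : EA →L[ℝ] EA => T Y) R.E_comp_E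
    change R.E (R.E Y) = R.E Y at this
    change R.E Y = X at hY
    rw [hY] at this
    exact this

/-- Two representations over the same `(g, f)` differ by an element of the kernel of `L`. Its Lie
algebra part is vertical, so `E` fixes it and the difference stays in the kernel. -/
theorem tangentCls_modelE_eq {g : GA} {f : F} {X X' : EA} {h h' : F}
    (H : R.tangentCls ρ ((g, X), (f, h)) = R.tangentCls ρ ((g, X'), (f, h'))) :
    R.tangentCls ρ ((g, R.modelE X), (f, h)) = R.tangentCls ρ ((g, R.modelE X'), (f, h')) := by
  obtain ⟨L, hL⟩ := R.exists_hasTangentMapAt_cls ρ g f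
  obtain ⟨P, hP⟩ := ((R.contMDiff_proj ρ).contMDiffAt (x := R.cls ρ (g, f))).exists_hasTangentMapAt
  have hv := TangentBundle.mk_eq_mk_iff.1
    ((BanachLieSubgroup.tangentCls_eq hL X h).symm.trans
      (H.trans (BanachLieSubgroup.tangentCls_eq hL X' h')))
  have h0 : L (X - X', h - h') = 0 := by
    rw [← Prod.mk_sub_mk, map_sub, hv, sub_self]
  have h1 : R.modelE (X - X') = X - X' := by
    rw [modelE_eq_self_iff]
    refine (R.hasTangentMapAt_proj_eq_zero_iff ρ hL hP (X - X', h - h')).1 ?_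
    rw [h0, map_zero]
  refine (BanachLieSubgroup.tangentCls_eq hL _ h).trans
    (Eq.trans ?_ (BanachLieSubgroup.tangentCls_eq hL _ h').symm)
  refine TangentBundle.mk_eq_mk rfl ?_
  rw [← sub_eq_zero, ← map_sub, Prod.mk_sub_mk, ← map_sub, h1, h0]

/-- Well-definedness of the connection: move both vectors to the same representative by
`tangentCls_mul`, where `E` commutes with `Ad(w)`. -/
theorem factorsThrough_tangentCls : FactorsThrough
    (fun p : (GA × GroupLieAlgebra 𝓘(ℝ, EA) GA) × (F × F) =>
      R.tangentCls ρ ((p.1.1, R.E p.1.2), p.2)) (R.tangentCls ρ) := by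
  rintro ⟨⟨g, X⟩, f, h⟩ ⟨⟨g', X'⟩, f', h'⟩ H
  have hb : R.cls ρ (g, f) = R.cls ρ (g', f') := congrArg Bundle.TotalSpace.proj H
  obtain ⟨w, h1, h2⟩ := (R.cls_eq_iff ρ).1 hb
  dsimp only at h1 h2 ⊢
  subst h1
  have h3 : ρ w f' = f := by
    rw [h2, ← mul_apply_eq_comp, ← map_mul]
    simp
  have hE : R.E (lieAd (w : GA) X') = lieAd (w : GA) (R.E X') :=
    congrArg (fun T : GroupLieAlgebra 𝓘(ℝ, EA) GA →L[ℝ] GroupLieAlgebra 𝓘(ℝ, EA) GA => T X')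
      (R.E_comp_ad w w.2)
  rw [R.tangentCls_mul, h3] at H ⊢
  rw [← hE]
  exact R.tangentCls_modelE_eq ρ H

theorem connection_tangentCls (g : GA) (X : GroupLieAlgebra 𝓘(ℝ, EA) GA) (f h : F) :
    R.connection ρ (R.tangentCls ρ ((g, X), (f, h))) = R.tangentCls ρ ((g, R.E X), (f, h)) :=
  (R.factorsThrough_tangentCls ρ).extend_apply id ((g, X), (f, h))

theorem isInducedMap_connection : R.IsInducedMap ρ (R.connection ρ) :=
  ⟨R.surjective_tangentCls ρ, R.connection_tangentCls ρ⟩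

theorem connection_mk {g : GA} {f : F} {L : EA × F →L[ℝ] R.Normal × F}
    (hL : HasTangentMapAt (𝓘(ℝ, EA).prod 𝓘(ℝ, F)) 𝓘(ℝ, R.Normal × F)
      (fun q : GA × F => R.cls ρ (g * q.1, q.2)) (1, f) L) (X : EA) (h : F) :
    R.connection ρ ⟨R.cls ρ (g, f), L (X, h)⟩ = ⟨R.cls ρ (g, f), L (R.modelE X, h)⟩ :=
  (congrArg (R.connection ρ) (BanachLieSubgroup.tangentCls_eq hL X h).symm).trans
    ((R.connection_tangentCls ρ g X f h).trans (BanachLieSubgroup.tangentCls_eq hL (R.modelE X) h))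

theorem connection_comp_connection : R.connection ρ ∘ R.connection ρ = R.connection ρ := by
  funext v
  obtain ⟨⟨⟨g, X⟩, f, h⟩, rfl⟩ := R.surjective_tangentCls ρ v
  have hE : R.E (R.E X) = R.E X :=
    congrArg (fun T : GroupLieAlgebra 𝓘(ℝ, EA) GA →L[ℝ] GroupLieAlgebra 𝓘(ℝ, EA) GA => T X)
      R.E_comp_E
  rw [comp_apply, connection_tangentCls, connection_tangentCls, hE]

theorem connection_fiberwise (x : R.HomogeneousBundle ρ) :
    ∃ L : TangentSpace 𝓘(ℝ, R.Normal × F) x →L[ℝ] TangentSpace 𝓘(ℝ, R.Normal × F) x,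
    (∀ v, R.connection ρ ⟨x, v⟩ = ⟨x, L v⟩) ∧ LinearMap.range L.toLinearMap =
      LinearMap.ker (mfderiv 𝓘(ℝ, R.Normal × F) 𝓘(ℝ, R.Normal) (R.proj ρ) x).toLinearMap := by
  obtain ⟨⟨g, f⟩, rfl⟩ := (R.isOpenQuotientMap_cls ρ).surjective x
  obtain ⟨L, hL⟩ := R.exists_hasTangentMapAt_cls ρ g f
  obtain ⟨T, hT⟩ := R.exists_rightInverse_of_hasTangentMapAt_cls ρ hL
  obtain ⟨P, hP⟩ := ((R.contMDiff_proj ρ).contMDiffAt (x := R.cls ρ (g, f))).exists_hasTangentMapAt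
  -- Lift by the right inverse `T`, apply `E` to the Lie algebra part, and project back. For
  -- vertical `v`, the Lie algebra part of `T v` lies in `𝔤_B`, so `Q v = v`.
  let Q : R.Normal × F →L[ℝ] R.Normal × F :=
    L.comp (((R.modelE.comp (.fst ℝ EA F)).prod (.snd ℝ EA F)).comp T)
  have hQ : ∀ v, Q v = L (R.modelE (T v).1, (T v).2) := fun v => rfl
  have key : ∀ v : R.Normal × F, (∃ u, Q u = v) ↔ P v = 0 := by
    intro v
    constructor
    · rintro ⟨u, rfl⟩
      rw [hQ, R.hasTangentMapAt_proj_eq_zero_iff ρ hL hP]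
      exact R.modelE_mem _
    · intro hv
      rw [← hT v, R.hasTangentMapAt_proj_eq_zero_iff ρ hL hP, ← R.modelE_eq_self_iff] at hv
      refine ⟨v, ?_⟩
      rw [hQ, hv]
      exact hT v
  refine ⟨Q, fun v => ?_, ?_⟩
  · have h1 := R.connection_mk ρ hL (T v).1 (T v).2
    exact (congrArg (R.connection ρ) (TangentBundle.mk_eq_mk rfl (hT v).symm)).trans h1
  · ext v
    exact (key v).trans
      (Iff.of_eq (congrArg (fun u : R.Normal => u = 0) (hP.mfderiv_apply v).symm))

/-- The connection in the coordinates of a bundle chart: there is an operator-valued linear map `A`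
such that `(c, f; u, h) ↦ (c, f; 0, h + A(E(θ(c) u)) f)`, where `θ` is the left logarithmic derivative
of the slice. -/
theorem exists_connection_in_chart : ∃ A : EA →L[ℝ] (F →L[ℝ] F),
    ∀ (g₀ : GA) (c : R.Normal) (f : F), c ∈ R.slice.U →
      ∀ e : R.Normal × F →L[ℝ] R.Normal × F, HasTangentMapAt 𝓘(ℝ, R.Normal × F) 𝓘(ℝ, R.Normal × F)
        (R.bundleChart ρ g₀) ((R.bundleChart ρ g₀).symm (c, f)) e →
      ∀ v : R.Normal × F, ∃ v' : R.Normal × F,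
        R.connection ρ ⟨(R.bundleChart ρ g₀).symm (c, f), v⟩ =
          ⟨(R.bundleChart ρ g₀).symm (c, f), v'⟩ ∧
        e v' = (0, (e v).2 + A (R.modelE (leftLogDeriv (E := EA) R.slice.σ c (e v).1)) f) := by
  obtain ⟨ι, hι, hιX⟩ := R.exists_hasTangentMapAt_val
  have h1W : (1 : GA) ∈ R.slice.W := ⟨0, R.slice.zero_mem, 1, one_mem _, by simp [R.slice.σ_zero]⟩
  -- Differentiating `ρ ∘ fib` extends `dρ` from `𝔤_B` to all of `𝔤_A`, so that `A ∘ E` is a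
  -- continuous linear map without inverting `ι` on its range.
  obtain ⟨A, hA⟩ := ((R.contMDiff_realRep ρ).contMDiffAt.comp (1 : GA)
    (R.slice.contMDiffOn_fib.contMDiffAt (R.slice.isOpen_W.mem_nhds h1W))).exists_hasTangentMapAt
  refine ⟨A, fun g₀ c f hc e he v => ?_⟩
  set g := g₀ * R.slice.σ c with hg
  have hgc : g₀⁻¹ * g = R.slice.σ c := by rw [hg]; group
  obtain ⟨L, hL⟩ := R.exists_hasTangentMapAt_cls ρ g f
  set θ : R.Normal →L[ℝ] EA := leftLogDeriv (E := EA) R.slice.σ c with hθ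
  have hθ' : HasTangentMapAt 𝓘(ℝ, R.Normal) 𝓘(ℝ, EA)
      (fun y => (R.slice.σ c)⁻¹ * R.slice.σ y) c θ :=
    hasMFDerivAt_leftLogDeriv R.slice.isOpen_U R.slice.smooth_σ hc
  have hsymm : (c, f) ∈ (R.bundleChart ρ g₀).target := ⟨hc, mem_univ _⟩
  have hright := (R.bundleChart ρ g₀).right_inv hsymm
  have hfst : HasTangentMapAt 𝓘(ℝ, R.Normal × F) 𝓘(ℝ, R.Normal) Prod.fst (c, f) (.fst ℝ _ _) :=
    .of_hasFDerivAt hasFDerivAt_fst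
  have hsnd : HasTangentMapAt 𝓘(ℝ, R.Normal × F) 𝓘(ℝ, F) Prod.snd (c, f) (.snd ℝ _ _) :=
    .of_hasFDerivAt hasFDerivAt_snd
  -- The chart inverse lifts to `(y, k) ↦ (g σ(c)⁻¹ σ(y), k)`, whose left-trivialized derivative at
  -- `(c, f)` is `(θ, id)`. Hence `v = L (θ u, h)` when `e v = (u, h)`.
  have hLe : L.comp (((θ.comp (.fst ℝ _ _)).prod (.snd ℝ _ _)).comp e) =
      .id ℝ (R.Normal × F) := by
    refine HasTangentMapAt.unique (hL.comp (((hθ'.comp hfst rfl).prodMk hsnd).comp he hright)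
      (by rw [hright, inv_mul_cancel])) ((HasTangentMapAt.id _).congr ?_)
    filter_upwards [(R.bundleChart ρ g₀).open_source.mem_nhds
      ((R.bundleChart ρ g₀).map_target hsymm)] with y hy
    conv_rhs => rw [← (R.bundleChart ρ g₀).left_inv hy, R.bundleChart_symm_apply]
    simp [BanachLieSubgroup.bundleSec, hg, mul_assoc]
  have hv : v = L (θ (e v).1, (e v).2) :=
    congrArg (fun T : R.Normal × F →L[ℝ] R.Normal × F => T v) hLe.symm
  refine ⟨L (R.modelE (θ (e v).1), (e v).2), ?_, ?_⟩
  · exact (congrArg (R.connection ρ) (TangentBundle.mk_eq_mk rfl hv)).trans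
      (R.connection_mk ρ hL (θ (e v).1) (e v).2)
  · obtain ⟨b, hb⟩ := (hιX _).1 (R.modelE_mem (θ (e v).1))
    rw [← hb]
    have hAι : HasTangentMapAt 𝓘(ℝ, EB) 𝓘(ℝ, F →L[ℝ] F) (R.realRep ρ) 1 (A.comp ι) := by
      refine (hA.comp hι rfl).congr (Filter.Eventually.of_forall fun w => ?_)
      simp only [comp_apply]
      rw [R.slice.fib_of_mem w.2]
    have hfst' : HasTangentMapAt (𝓘(ℝ, EB).prod 𝓘(ℝ, F)) 𝓘(ℝ, EB) Prod.fst
      ((1 : R.toSubgroup), f) (.fst ℝ _ _) := .fst _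
    have hsnd' : HasTangentMapAt (𝓘(ℝ, EB).prod 𝓘(ℝ, F)) 𝓘(ℝ, F) Prod.snd
      ((1 : R.toSubgroup), f) (.snd ℝ _ _) := .snd _
    -- In the chart, `[(g w, k)]` with `w` in the subgroup is `(c, ρ(w) k)`. The derivative at `(1,
    -- f)` in direction `(b, h)` is therefore `(0, h + A(ι b) f)`.
    have h1 := (he.comp (hL.comp ((hι.comp hfst' rfl).prodMk hsnd') rfl) (by
      simp only [OneMemClass.coe_one, mul_one]
      rfl)).unique (((HasTangentMapAt.const _ c).prodMk_space
        ((hAι.comp hfst' rfl).clm_apply hsnd')).congr (Filter.Eventually.of_forall fun q => by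
          have hW : g₀⁻¹ * (g * q.1) ∈ R.slice.W := by
            rw [← mul_assoc, hgc]
            exact (R.slice.mul_mem_W (R.slice.σ_mem hc) q.1.2).1
          refine (R.bundleChart_cls ρ (p := (g * q.1, q.2)) hW).trans ?_
          dsimp only [BanachLieSubgroup.bundleCoord]
          rw [← mul_assoc, hgc, R.slice.r_eq c hc _ q.1.2, R.slice.fib_σ_mul hc]
          rfl))
    have h2 := congrArg (fun T : EB × F →L[ℝ] R.Normal × F => T (b, (e v).2)) h1
    simpa using h2

theorem contMDiff_connection [IsManifold 𝓘(ℝ, R.Normal × F) ∞ (R.HomogeneousBundle ρ)] :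
    ContMDiff 𝓘(ℝ, R.Normal × F).tangent 𝓘(ℝ, R.Normal × F).tangent ∞ (R.connection ρ) := by
  obtain ⟨A, hA⟩ := R.exists_connection_in_chart ρ
  have hproj : ∀ z, (R.connection ρ z).proj = z.proj := by
    intro z
    obtain ⟨⟨⟨g, X⟩, f, h⟩, rfl⟩ := R.surjective_tangentCls ρ z
    rw [connection_tangentCls]
    rfl
  intro z₀
  have hid : ContMDiffAt 𝓘(ℝ, R.Normal × F).tangent 𝓘(ℝ, R.Normal × F).tangent ∞ id z₀ :=
    contMDiffAt_id
  rw [Bundle.contMDiffAt_totalSpace] at hid ⊢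
  obtain ⟨hid1, hid2⟩ := hid
  refine ⟨hid1.congr_of_eventuallyEq (Filter.Eventually.of_forall hproj), ?_⟩
  rw [hproj]
  set x₀ := z₀.proj
  obtain ⟨g₀, hg₀⟩ : ∃ g₀, chartAt (R.Normal × F) x₀ = R.bundleChart ρ g₀ := ⟨_, rfl⟩
  have hsrc : ∀ᶠ z in 𝓝 z₀, z.proj ∈ (R.bundleChart ρ g₀).source := by
    refine hid1.continuousAt.eventually ((R.bundleChart ρ g₀).open_source.mem_nhds ?_)
    rw [← hg₀]
    exact mem_chart_source _ x₀
  have hcoord : ContMDiffAt 𝓘(ℝ, R.Normal × F).tangent 𝓘(ℝ, R.Normal × F) ∞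
      (fun z : TangentBundle 𝓘(ℝ, R.Normal × F) (R.HomogeneousBundle ρ) =>
        R.bundleChart ρ g₀ z.proj) z₀ :=
    ((R.contMDiffOn_bundleChart ρ g₀).contMDiffAt ((R.bundleChart ρ g₀).open_source.mem_nhds
      hsrc.self_of_nhds)).comp z₀ hid1
  -- The vector part of the connection in coordinates, a function of base point and vector; its only
  -- nonlinear dependence on the base coordinate is through the logarithmic derivative of the slice.
  let Θ : (R.Normal × F) × (R.Normal × F) → R.Normal × F := fun q =>
    (0, q.2.2 + A (R.modelE (leftLogDeriv (E := EA) R.slice.σ q.1.1 q.2.1)) q.1.2)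
  have hΘ : ContDiffOn ℝ ∞ Θ ((R.slice.U ×ˢ univ) ×ˢ univ) := by
    have h1 : ContDiffOn ℝ ∞ (fun q : (R.Normal × F) × (R.Normal × F) =>
        leftLogDeriv (E := EA) R.slice.σ q.1.1) ((R.slice.U ×ˢ univ) ×ˢ univ) :=
      (contDiffOn_leftLogDeriv R.slice.isOpen_U R.slice.smooth_σ).comp (by fun_prop)
        (fun q hq => hq.1.1)
    have h2 : ContDiffOn ℝ ∞ (fun q : (R.Normal × F) × (R.Normal × F) =>
        leftLogDeriv (E := EA) R.slice.σ q.1.1 q.2.1) ((R.slice.U ×ˢ univ) ×ˢ univ) :=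
      h1.clm_apply (by fun_prop)
    refine contDiffOn_const.prodMk (ContDiffOn.add (by fun_prop) (ContDiffOn.clm_apply ?_
      (by fun_prop)))
    exact (A.comp R.modelE).contDiff.comp_contDiffOn h2
  have hmem : ∀ z : TangentBundle 𝓘(ℝ, R.Normal × F) (R.HomogeneousBundle ρ),
      z.proj ∈ (R.bundleChart ρ g₀).source →
      (R.bundleChart ρ g₀ z.proj).1 ∈ R.slice.U := fun z hz =>
    ((R.bundleChart ρ g₀).map_source hz).1
  have hΘz : ContDiffAt ℝ ∞ Θ (R.bundleChart ρ g₀ z₀.proj,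
      (trivializationAt (R.Normal × F) (TangentSpace 𝓘(ℝ, R.Normal × F)) x₀ z₀).2) :=
    hΘ.contDiffAt (((R.slice.isOpen_U.prod isOpen_univ).prod isOpen_univ).mem_nhds
      ⟨⟨hmem z₀ hsrc.self_of_nhds, mem_univ _⟩, mem_univ _⟩)
  refine (hΘz.contMDiffAt.comp z₀ (hcoord.prodMk_space hid2)).congr_of_eventuallyEq ?_
  filter_upwards [hsrc] with z hz
  -- The trivialization of `TD` at `x₀` is the derivative of the preferred chart there, which is a
  -- bundle chart.
  have htriv : ∀ (v : R.Normal × F) (e : R.Normal × F →L[ℝ] R.Normal × F),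
      HasTangentMapAt 𝓘(ℝ, R.Normal × F) 𝓘(ℝ, R.Normal × F) (R.bundleChart ρ g₀) z.proj e →
      (trivializationAt (R.Normal × F) (TangentSpace 𝓘(ℝ, R.Normal × F)) x₀ ⟨z.proj, v⟩).2 = e v := by
    intro v e he
    have hz' : z.proj ∈ (chartAt (R.Normal × F) x₀).source := hg₀ ▸ hz
    have h1 := TangentBundle.continuousLinearMapAt_trivializationAt (I := 𝓘(ℝ, R.Normal × F)) hz'
    rw [← he.mfderiv_apply]
    have h2 : (trivializationAt (R.Normal × F) (TangentSpace 𝓘(ℝ, R.Normal × F))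
        x₀).continuousLinearMapAt ℝ z.proj v = (trivializationAt (R.Normal × F)
        (TangentSpace 𝓘(ℝ, R.Normal × F)) x₀ ⟨z.proj, v⟩).2 := by
      rw [Bundle.Trivialization.continuousLinearMapAt_apply,
        Bundle.Trivialization.coe_linearMapAt_of_mem]
      simpa using hz'
    rw [← h2, h1, ← hg₀]
    simp only [mfld_simps]
    rfl
  obtain ⟨e, he⟩ := ((R.contMDiffOn_bundleChart ρ g₀).contMDiffAt
    ((R.bundleChart ρ g₀).open_source.mem_nhds hz)).exists_hasTangentMapAt
  have hy := (R.bundleChart ρ g₀).left_inv hz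
  obtain ⟨v', hv', hev'⟩ := hA g₀ (R.bundleChart ρ g₀ z.proj).1 (R.bundleChart ρ g₀ z.proj).2
    (hmem z hz) e (by rw [Prod.mk.eta, hy]; exact he) z.2
  rw [Prod.mk.eta, hy] at hv'
  have h3 : R.connection ρ z = ⟨z.proj, v'⟩ := hv'
  have h4 := htriv z.2 e he
  rw [h3, htriv v' e he, hev']
  simp only [Θ, comp_apply]
  rw [← h4]
  rfl

theorem isConnection_connection [IsManifold 𝓘(ℝ, R.Normal × F) ∞ (R.HomogeneousBundle ρ)] :
    IsConnection (EZ := R.Normal) (R.proj ρ) (R.connection ρ) :=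
  ⟨R.contMDiff_connection ρ, R.connection_comp_connection ρ, R.connection_fiberwise ρ⟩

end ReductiveStructure

/-! ### Fibres of the homogeneous bundle and their tangent vectors -/

namespace BanachLieSubgroup

variable {EA EB GA F : Type*} [NormedAddCommGroup EA] [NormedSpace ℝ EA] [CompleteSpace EA]
  [NormedAddCommGroup EB] [NormedSpace ℝ EB] [TopologicalSpace GA] [ChartedSpace EA GA] [Group GA]
  [LieGroup 𝓘(ℝ, EA) ∞ GA] [NormedAddCommGroup F] [NormedSpace ℂ F]
  (S : BanachLieSubgroup EA EB GA) (ρ : S.toSubgroup →ₜ* (F →L[ℂ] F))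

theorem exists_cls_eq_of_proj_eq {x : S.HomogeneousBundle ρ} {g : GA}
    (hx : S.proj ρ x = S.coset g) : ∃ f, S.cls ρ (g, f) = x := by
  obtain ⟨⟨g', f'⟩, rfl⟩ := (S.isOpenQuotientMap_cls ρ).surjective x
  have h : g'⁻¹ * g ∈ S.toSubgroup := S.coset_eq_iff.1 hx
  refine ⟨ρ (⟨_, h⟩ : S.toSubgroup)⁻¹ f', ((S.cls_eq_iff ρ).2 ⟨⟨_, h⟩, ?_, rfl⟩).symm⟩
  simp

theorem bundleChart_cls_self (g : GA) (f : F) : S.bundleChart ρ g (S.cls ρ (g, f)) = (0, f) := by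
  rw [S.bundleChart_cls ρ (p := (g, f)) (S.self_mem_translate_W g)]
  have h1 : S.slice.r 1 = 0 := by simpa [S.slice.σ_zero] using S.slice.r_σ S.slice.zero_mem
  have h2 : S.slice.fib (1 : GA) = 1 := S.slice.fib_of_mem (one_mem _)
  simp [bundleCoord, h1, h2]

theorem cls_injective_right (g : GA) {f f' : F} (h : S.cls ρ (g, f) = S.cls ρ (g, f')) : f = f' := by
  have := congrArg (S.bundleChart ρ g) h
  rw [bundleChart_cls_self, bundleChart_cls_self] at this
  exact (Prod.ext_iff.1 this).2

variable {ρ S} [CompleteSpace F]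

/-- Vertical tangent vectors are tangent to the fibre. -/
theorem exists_eq_of_mem_lieSubalgebra {g : GA} {f : F} {L : EA × F →L[ℝ] S.Normal × F}
    (hL : HasTangentMapAt (𝓘(ℝ, EA).prod 𝓘(ℝ, F)) 𝓘(ℝ, S.Normal × F)
      (fun q : GA × F => S.cls ρ (g * q.1, q.2)) (1, f) L) {X : EA} (hX : X ∈ S.lieSubalgebra)
    (h : F) : ∃ k : F, L (X, h) = L (0, k) := by
  obtain ⟨ι, hι, hιX⟩ := S.exists_hasTangentMapAt_val
  obtain ⟨b, rfl⟩ := (hιX X).1 hX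
  obtain ⟨d, hd⟩ := (S.contMDiff_realRep ρ).contMDiffAt.exists_hasTangentMapAt
    (x := (1 : S.toSubgroup))
  have hfst : HasTangentMapAt (𝓘(ℝ, EB).prod 𝓘(ℝ, F)) 𝓘(ℝ, EB) Prod.fst
    ((1 : S.toSubgroup), f) (.fst ℝ _ _) := .fst _
  have hsnd : HasTangentMapAt (𝓘(ℝ, EB).prod 𝓘(ℝ, F)) 𝓘(ℝ, F) Prod.snd
    ((1 : S.toSubgroup), f) (.snd ℝ _ _) := .snd _
  -- Differentiate `[(g w, k)] = [(g, ρ(w) k)]`: the group direction moves entirely into the fibre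
  -- direction.
  have h1 := (hL.comp ((hι.comp hfst rfl).prodMk hsnd) rfl).unique
    ((hL.comp ((HasTangentMapAt.const _ (1 : GA)).prodMk ((hd.comp hfst rfl).clm_apply hsnd))
      (by simp)).congr (Filter.Eventually.of_forall fun q => by
        dsimp only
        rw [cls_eq_iff]
        refine ⟨q.1⁻¹, by simp, by simp [realRep_apply]⟩))
  have h2 := congrArg (fun T : EB × F →L[ℝ] S.Normal × F => T (b, h)) h1
  exact ⟨_, h2⟩

/-- The tangent vectors `[((g, 0), (f, k))]` are determined by `k`. -/
theorem eq_zero_of_hasTangentMapAt_cls {g : GA} {f : F} {L : EA × F →L[ℝ] S.Normal × F}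
    (hL : HasTangentMapAt (𝓘(ℝ, EA).prod 𝓘(ℝ, F)) 𝓘(ℝ, S.Normal × F)
      (fun q : GA × F => S.cls ρ (g * q.1, q.2)) (1, f) L) {k : F} (hk : L (0, k) = 0) : k = 0 := by
  have hsrc : S.cls ρ (g, f) ∈ (S.bundleChart ρ g).source :=
    (S.mem_bundleChart_source ρ).2 (S.self_mem_translate_W g)
  obtain ⟨e, he⟩ := ((S.contMDiffOn_bundleChart ρ g).contMDiffAt
    ((S.bundleChart ρ g).open_source.mem_nhds hsrc)).exists_hasTangentMapAt
  -- The chart reads `[(g, q)]` as `(0, q)`, so its derivative recovers `k` from `L (0, k)`.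
  have h1 := (he.comp (hL.comp ((HasTangentMapAt.const (I := 𝓘(ℝ, F)) f (1 : GA)).prodMk
    (HasTangentMapAt.id f)) rfl) (by simp)).unique
    (((HasTangentMapAt.const f (0 : S.Normal)).prodMk_space (HasTangentMapAt.id f)).congr
      (Filter.Eventually.of_forall fun q => by simp [bundleChart_cls_self]))
  have h2 := congrArg (fun T : F →L[ℝ] S.Normal × F => T k) h1
  have h3 : e (L (0, k)) = (0, k) := h2
  rw [hk, map_zero] at h3
  exact (Prod.ext_iff.1 h3).2.symm

end BanachLieSubgroup

/-! ### Morphisms of reductive structures and the pull-back -/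

namespace ReductiveStructure.Hom

variable {EA EB GA EA' EB' GA' F : Type*}
  [NormedAddCommGroup EA] [NormedSpace ℝ EA] [CompleteSpace EA]
  [NormedAddCommGroup EB] [NormedSpace ℝ EB]
  [TopologicalSpace GA] [ChartedSpace EA GA] [Group GA] [LieGroup 𝓘(ℝ, EA) ∞ GA]
  [NormedAddCommGroup EA'] [NormedSpace ℝ EA'] [CompleteSpace EA']
  [NormedAddCommGroup EB'] [NormedSpace ℝ EB']
  [TopologicalSpace GA'] [ChartedSpace EA' GA'] [Group GA'] [LieGroup 𝓘(ℝ, EA') ∞ GA']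
  [NormedAddCommGroup F] [NormedSpace ℂ F] [CompleteSpace F]
  {R : ReductiveStructure EA EB GA} {R' : ReductiveStructure EA' EB' GA'} (α : R.Hom R')
  (ρ' : R'.toSubgroup →ₜ* (F →L[ℂ] F))

/-- Near each point the map is a local section followed by `α` and the projection; the same device
gives smoothness on total spaces. -/
theorem contMDiff_baseMap : ContMDiff 𝓘(ℝ, R.Normal) 𝓘(ℝ, R'.Normal) ∞ α.baseMap := by
  intro x
  obtain ⟨g, rfl⟩ := R.isOpenQuotientMap_coset.surjective x
  obtain ⟨s, hs, hsx, hcs⟩ := R.exists_localSection_coset g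
  refine ((R'.contMDiff_coset.comp α.contMDiff_toFun).contMDiffAt.comp _ hs).congr_of_eventuallyEq ?_
  filter_upwards [hcs] with y hy
  conv_lhs => rw [← hy]
  rfl

theorem contMDiff_bundleMap :
    ContMDiff 𝓘(ℝ, R.Normal × F) 𝓘(ℝ, R'.Normal × F) ∞ (α.bundleMap ρ') := by
  intro x
  obtain ⟨p, rfl⟩ := (R.isOpenQuotientMap_cls (α.pullRep ρ')).surjective x
  obtain ⟨s, hs, hsx, hcs⟩ := R.exists_localSection_cls (α.pullRep ρ') p
  refine (((R'.contMDiff_cls ρ').comp ((α.contMDiff_toFun.comp contMDiff_fst).prodMk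
    contMDiff_snd)).contMDiffAt.comp _ hs).congr_of_eventuallyEq ?_
  filter_upwards [hcs] with y hy
  conv_lhs => rw [← hy]
  rfl

theorem bundleMap_cls (g : GA) (f : F) :
    α.bundleMap ρ' (R.cls (α.pullRep ρ') (g, f)) = R'.cls ρ' (α.toFun g, f) := rfl

theorem isFiberwiseDiffeoBundleHom : IsFiberwiseDiffeoBundleHom (R.Normal × F) R.Normal
    (R'.Normal × F) R'.Normal (R.proj (α.pullRep ρ')) (R'.proj ρ') (α.bundleMap ρ') α.baseMap where
  smooth_proj := R.contMDiff_proj (α.pullRep ρ')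
  smooth_proj' := R'.contMDiff_proj ρ'
  smooth_total := α.contMDiff_bundleMap ρ'
  smooth_base := α.contMDiff_baseMap
  comm := by
    funext x
    obtain ⟨p, rfl⟩ := (R.isOpenQuotientMap_cls (α.pullRep ρ')).surjective x
    rfl
  fiber_bijOn s := by
    obtain ⟨g, rfl⟩ := R.isOpenQuotientMap_coset.surjective s
    refine ⟨?_, ?_, ?_⟩
    · intro x hx
      obtain ⟨f, rfl⟩ := R.exists_cls_eq_of_proj_eq (α.pullRep ρ') hx
      rfl
    · intro x hx y hy hxy
      obtain ⟨f, rfl⟩ := R.exists_cls_eq_of_proj_eq (α.pullRep ρ') hx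
      obtain ⟨f', rfl⟩ := R.exists_cls_eq_of_proj_eq (α.pullRep ρ') hy
      rw [bundleMap_cls, bundleMap_cls] at hxy
      rw [R'.cls_injective_right ρ' _ hxy]
    · intro y hy
      obtain ⟨f, rfl⟩ := R'.exists_cls_eq_of_proj_eq ρ' (g := α.toFun g) hy
      exact ⟨R.cls (α.pullRep ρ') (g, f), rfl, rfl⟩
  fiber_smooth_inv s := by
    obtain ⟨g, rfl⟩ := R.isOpenQuotientMap_coset.surjective s
    -- On the fibre over `α(g)`, the chart there recovers `f` from `[(α(g), f)]`, and `[(g, f)]` is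
    -- the preimage.
    refine ⟨fun y => R.cls (α.pullRep ρ') (g, (R'.bundleChart ρ' (α.toFun g) y).2), ?_, ?_⟩
    · intro x hx
      obtain ⟨f, rfl⟩ := R.exists_cls_eq_of_proj_eq (α.pullRep ρ') hx
      rw [bundleMap_cls]
      dsimp only
      rw [R'.bundleChart_cls_self]
    · refine (R.contMDiff_cls (α.pullRep ρ')).comp_contMDiffOn (contMDiffOn_const.prodMk ?_)
      refine contDiff_snd.contMDiff.comp_contMDiffOn
        ((R'.contMDiffOn_bundleChart ρ' (α.toFun g)).mono ?_)
      intro y hy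
      obtain ⟨f, rfl⟩ := R'.exists_cls_eq_of_proj_eq ρ' (g := α.toFun g) hy
      exact (R'.mem_bundleChart_source ρ').2 (R'.self_mem_translate_W _)

theorem exists_hasTangentMapAt_one : ∃ A : EA →L[ℝ] EA',
    HasTangentMapAt 𝓘(ℝ, EA) 𝓘(ℝ, EA') α.toFun 1 A ∧
      ∀ X : EA, lieDerived α.toContMDiffMonoidMorphism X = A X :=
  ⟨_, (α.contMDiff_toFun.contMDiffAt.mdifferentiableAt (by simp)).hasMFDerivAt, fun _ => rfl⟩

/-- The tangent map of `δ` in the left trivializations. -/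
theorem hasTangentMapAt_bundleMap {A : EA →L[ℝ] EA'}
    (hα : HasTangentMapAt 𝓘(ℝ, EA) 𝓘(ℝ, EA') α.toFun 1 A) {g : GA} {f : F} {L : EA × F →L[ℝ] R.Normal × F}
    (hL : HasTangentMapAt (𝓘(ℝ, EA).prod 𝓘(ℝ, F)) 𝓘(ℝ, R.Normal × F)
      (fun q : GA × F => R.cls (α.pullRep ρ') (g * q.1, q.2)) (1, f) L)
    {L' : EA' × F →L[ℝ] R'.Normal × F}
    (hL' : HasTangentMapAt (𝓘(ℝ, EA').prod 𝓘(ℝ, F)) 𝓘(ℝ, R'.Normal × F)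
      (fun q : GA' × F => R'.cls ρ' (α.toFun g * q.1, q.2)) (1, f) L')
    {D : R.Normal × F →L[ℝ] R'.Normal × F}
    (hD : HasTangentMapAt 𝓘(ℝ, R.Normal × F) 𝓘(ℝ, R'.Normal × F) (α.bundleMap ρ')
      (R.cls (α.pullRep ρ') (g, f)) D) (X : EA) (h : F) :
    D (L (X, h)) = L' (A X, h) := by
  -- Differentiate `δ [(g x, k)] = [(α(g) α(x), k)]` at `(1, f)`.
  have h1 := (hD.comp hL (by simp)).unique
    ((hL'.comp ((hα.comp (HasTangentMapAt.fst (1, f)) rfl).prodMk (HasTangentMapAt.snd (1, f)))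
      (by simp)).congr (Filter.Eventually.of_forall fun q => by
        dsimp only
        rw [bundleMap_cls]
        simp))
  exact congrArg (fun T : EA × F →L[ℝ] R'.Normal × F => T (X, h)) h1

theorem tangentMap_bundleMap_tangentCls (g : GA) (X : GroupLieAlgebra 𝓘(ℝ, EA) GA) (f h : F) :
    tangentMap 𝓘(ℝ, R.Normal × F) 𝓘(ℝ, R'.Normal × F) (α.bundleMap ρ')
      (R.tangentCls (α.pullRep ρ') ((g, X), (f, h))) =
    R'.tangentCls ρ' ((α.toFun g, lieDerived α.toContMDiffMonoidMorphism X), (f, h)) := by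
  obtain ⟨L, hL⟩ := R.exists_hasTangentMapAt_cls (α.pullRep ρ') g f
  obtain ⟨L', hL'⟩ := R'.exists_hasTangentMapAt_cls ρ' (α.toFun g) f
  obtain ⟨D, hD⟩ := (α.contMDiff_bundleMap ρ').contMDiffAt.exists_hasTangentMapAt
    (x := R.cls (α.pullRep ρ') (g, f))
  obtain ⟨A, hα, hA⟩ := α.exists_hasTangentMapAt_one
  refine (congrArg _ (BanachLieSubgroup.tangentCls_eq hL X h)).trans
    (Eq.trans ?_ (BanachLieSubgroup.tangentCls_eq hL' _ h).symm)
  refine (hD.tangentMap_mk _).trans (TangentBundle.mk_eq_mk rfl ?_)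
  exact (α.hasTangentMapAt_bundleMap ρ' hα hL hL' hD X h).trans
    (congrArg (fun Y : EA' => L' (Y, h)) (hA X).symm)

/-- On representatives, `Tδ` applies `dα` to the Lie algebra part only, so the relation is `dα ∘ E =
Ẽ ∘ dα`. -/
theorem tangentMap_comp_connection :
    tangentMap 𝓘(ℝ, R.Normal × F) 𝓘(ℝ, R'.Normal × F) (α.bundleMap ρ') ∘
      R.connection (α.pullRep ρ') =
    R'.connection ρ' ∘ tangentMap 𝓘(ℝ, R.Normal × F) 𝓘(ℝ, R'.Normal × F) (α.bundleMap ρ') := by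
  funext v
  obtain ⟨⟨⟨g, X⟩, f, h⟩, rfl⟩ := R.surjective_tangentCls (α.pullRep ρ') v
  have hE : lieDerived α.toContMDiffMonoidMorphism (R.E X) =
      R'.E (lieDerived α.toContMDiffMonoidMorphism X) :=
    congrArg (fun T : GroupLieAlgebra 𝓘(ℝ, EA) GA →L[ℝ] GroupLieAlgebra 𝓘(ℝ, EA') GA' => T X)
      α.derived_comp_E
  rw [comp_apply, comp_apply, connection_tangentCls, tangentMap_bundleMap_tangentCls,
    tangentMap_bundleMap_tangentCls, connection_tangentCls, hE]

/-- `Tδ` is injective on vertical vectors. -/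
theorem eq_zero_of_vertical {x : R.HomogeneousBundle (α.pullRep ρ')}
    {D : R.Normal × F →L[ℝ] R'.Normal × F}
    (hD : HasTangentMapAt 𝓘(ℝ, R.Normal × F) 𝓘(ℝ, R'.Normal × F) (α.bundleMap ρ') x D)
    {P : R.Normal × F →L[ℝ] R.Normal}
    (hP : HasTangentMapAt 𝓘(ℝ, R.Normal × F) 𝓘(ℝ, R.Normal) (R.proj (α.pullRep ρ')) x P)
    {v : R.Normal × F} (hPv : P v = 0) (hDv : D v = 0) : v = 0 := by
  obtain ⟨⟨g, f⟩, rfl⟩ := (R.isOpenQuotientMap_cls (α.pullRep ρ')).surjective x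
  obtain ⟨L, hL⟩ := R.exists_hasTangentMapAt_cls (α.pullRep ρ') g f
  obtain ⟨L', hL'⟩ := R'.exists_hasTangentMapAt_cls ρ' (α.toFun g) f
  obtain ⟨T, hT⟩ := R.exists_rightInverse_of_hasTangentMapAt_cls (α.pullRep ρ') hL
  rw [← hT v, R.hasTangentMapAt_proj_eq_zero_iff (α.pullRep ρ') hL hP] at hPv
  -- A vertical vector is `L (0, k)`; its image `L' (0, k)` vanishes only for `k = 0`.
  obtain ⟨k, hk⟩ := BanachLieSubgroup.exists_eq_of_mem_lieSubalgebra hL hPv (T v).2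
  have hv : v = L (0, k) := by rw [← hk]; exact (hT v).symm
  obtain ⟨A, hα, -⟩ := α.exists_hasTangentMapAt_one
  rw [hv, α.hasTangentMapAt_bundleMap ρ' hα hL hL' hD, map_zero] at hDv
  rw [hv, BanachLieSubgroup.eq_zero_of_hasTangentMapAt_cls hL' hDv]
  exact map_zero L

/-- At each vector both connections take vertical values with equal images under `Tδ`, and `Tδ` is
injective on vertical vectors. -/
theorem connection_unique [IsManifold 𝓘(ℝ, R.Normal × F) ∞ (R.HomogeneousBundle (α.pullRep ρ'))]
    {Ψ : TangentBundle 𝓘(ℝ, R.Normal × F) (R.HomogeneousBundle (α.pullRep ρ')) →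
      TangentBundle 𝓘(ℝ, R.Normal × F) (R.HomogeneousBundle (α.pullRep ρ'))}
    (hΨ : IsConnection (EZ := R.Normal) (R.proj (α.pullRep ρ')) Ψ)
    (h : tangentMap 𝓘(ℝ, R.Normal × F) 𝓘(ℝ, R'.Normal × F) (α.bundleMap ρ') ∘ Ψ =
      R'.connection ρ' ∘ tangentMap 𝓘(ℝ, R.Normal × F) 𝓘(ℝ, R'.Normal × F) (α.bundleMap ρ')) :
    Ψ = R.connection (α.pullRep ρ') := by
  funext ⟨x, v⟩
  obtain ⟨L₁, h₁, hr₁⟩ := hΨ.fiberwise x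
  obtain ⟨L₂, h₂, hr₂⟩ := R.connection_fiberwise (α.pullRep ρ') x
  obtain ⟨D, hD⟩ := (α.contMDiff_bundleMap ρ').contMDiffAt.exists_hasTangentMapAt (x := x)
  obtain ⟨P, hP⟩ := (R.contMDiff_proj (α.pullRep ρ')).contMDiffAt.exists_hasTangentMapAt (x := x)
  let a : R.Normal × F := L₁ v
  let b : R.Normal × F := L₂ v
  have ha : P a = 0 := by
    have : L₁ v ∈ LinearMap.range L₁.toLinearMap := ⟨v, rfl⟩
    rw [hr₁] at this
    exact (hP.mfderiv_apply a).symm.trans this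
  have hb : P b = 0 := by
    have : L₂ v ∈ LinearMap.range L₂.toLinearMap := ⟨v, rfl⟩
    rw [hr₂] at this
    exact (hP.mfderiv_apply b).symm.trans this
  have e1 := congrFun (h.trans (α.tangentMap_comp_connection ρ').symm) ⟨x, v⟩
  rw [comp_apply, comp_apply, h₁, h₂] at e1
  have e2 : D a = D b := TangentBundle.mk_eq_mk_iff.1
    ((hD.tangentMap_mk a).symm.trans (e1.trans (hD.tangentMap_mk b)))
  have e3 : a - b = 0 := α.eq_zero_of_vertical ρ' hD hP (by rw [map_sub, ha, hb, sub_zero])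
    (by rw [map_sub, e2, sub_self])
  rw [h₁, h₂]
  exact TangentBundle.mk_eq_mk rfl (sub_eq_zero.1 e3)

end ReductiveStructure.Hom

/-! ### The pull-back of the induced connection -/

theorem proposition2p5 {EA EB GA EA' EB' GA' F : Type*}
    [NormedAddCommGroup EA] [NormedSpace ℝ EA] [CompleteSpace EA]
    [NormedAddCommGroup EB] [NormedSpace ℝ EB] [CompleteSpace EB]
    [TopologicalSpace GA] [ChartedSpace EA GA] [Group GA] [LieGroup 𝓘(ℝ, EA) ∞ GA]
    [NormedAddCommGroup EA'] [NormedSpace ℝ EA'] [CompleteSpace EA']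
    [NormedAddCommGroup EB'] [NormedSpace ℝ EB'] [CompleteSpace EB']
    [TopologicalSpace GA'] [ChartedSpace EA' GA'] [Group GA'] [LieGroup 𝓘(ℝ, EA') ∞ GA']
    [NormedAddCommGroup F] [InnerProductSpace ℂ F] [CompleteSpace F]
    (R : ReductiveStructure EA EB GA) (R' : ReductiveStructure EA' EB' GA') (α : R.Hom R')
    (ρ' : R'.toSubgroup →ₜ* (F →L[ℂ] F)) :
    -- the quotients are Banach manifolds
    ∃ (_ : IsManifold 𝓘(ℝ, R.Normal) ∞ R.Base) (_ : IsManifold 𝓘(ℝ, R'.Normal) ∞ R'.Base)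
      (_ : IsManifold 𝓘(ℝ, R.Normal × F) ∞ (R.HomogeneousBundle (α.pullRep ρ')))
      (_ : IsManifold 𝓘(ℝ, R'.Normal × F) ∞ (R'.HomogeneousBundle ρ')),
      -- the maps `Φ_E` and `Φ̃_Ẽ` are well defined by their formulas
      R.IsInducedMap (α.pullRep ρ') (R.connection (α.pullRep ρ')) ∧
      R'.IsInducedMap ρ' (R'.connection ρ') ∧
      -- `Θ^*(Φ̃_Ẽ) = Φ_E`
      IsPullbackConnection (EZ := R.Normal) (EZ' := R'.Normal)
        (R.proj (α.pullRep ρ')) (R'.proj ρ') (α.bundleMap ρ') α.baseMap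
        (R'.connection ρ') (R.connection (α.pullRep ρ')) :=
  have := R.isManifold_homogeneousBundle (α.pullRep ρ')
  have := R'.isManifold_homogeneousBundle ρ'
  ⟨R.isManifold_base, R'.isManifold_base, R.isManifold_homogeneousBundle (α.pullRep ρ'),
    R'.isManifold_homogeneousBundle ρ', R.isInducedMap_connection (α.pullRep ρ'),
    R'.isInducedMap_connection ρ', α.isFiberwiseDiffeoBundleHom ρ',
    R'.isConnection_connection ρ', R.isConnection_connection (α.pullRep ρ'),
    α.tangentMap_comp_connection ρ', fun _ hΨ h => α.connection_unique ρ' hΨ h⟩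

end
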